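/- Let $n_1,n_2\ge 1$ and let $\boldsymbol T=(T_{ij})\in\{0,1\}^{n_1\times n_2}$ have mutually independent entries with $\pi_{ij}=\Pr(T_{ij}=1)\ge \pi_L$ for all $i,j$, where $\pi_L>0$. Write $\boldsymbol J$ for the $n_1\times n_2$ matrix of ones, $\circ$ for the entrywise product, $\langle \boldsymbol A,\boldsymbol B\rangle=\sum_{i,j}A_{ij}B_{ij}$, $\|\cdot\|$ for the spectral norm, $\|\cdot\|_F$ for the Frobenius norm, and $$\|\boldsymbol C\|_{\max}=\inf\{\|\boldsymbol U\|_{2,\infty}\|\boldsymbol V\|_{2,\infty}:\boldsymbol C=\boldsymbol U\boldsymbol V^{\intercal}\}$$ for the max norm, where $\|\cdot\|_{2,\infty}$ is the maximal Euclidean norm of a row. For weights $\boldsymbol W\in\mathbb R^{n_1\times n_2}$ define the balancing error $$S(\boldsymbol W,\boldsymbol\Delta)=\frac1{n_1n_2}\bigl|\langle\boldsymbol\Delta,(\boldsymbol T\circ\boldsymbol W-\boldsymbol J)\circ\boldsymbol\Delta\rangle\bigr| .$$ Let $\kappa\ge(2\sum_{i,j}\pi_{ij}^{-1})^{1/2}$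 and let $\widehat{\boldsymbol W}$ be a solution of the balancing optimization $$\min_{\boldsymbol W}\ \|\boldsymbol T\circ\boldsymbol W-\boldsymbol J\|\quad\text{subject to}\quad \|\boldsymbol T\circ\boldsymbol W\|_F\le\kappa,\quad W_{ij}\ge 1\ \text{for all } i,j .$$ There is an absolute constant $C>0$ (independent of $n_1,n_2,(\pi_{ij}),\pi_L,\kappa,\beta'$ and the probability space) such that the following holds. (i) With probability at least $1-\exp\{-2^{-1}(\log 2)\,\pi_L^2\sum_{i,j}\pi_{ij}^{-1}\}$, the oracle weights $\boldsymbol W_\diamond=(\pi_{ij}^{-1})$ are feasible for the balancing optimization. (ii) For every $\beta'\ge 0$, with probability at least $1-\exp\{-2^{-1}(\log 2)\,\pi_L^2\sum_{i,j}\pi_{ij}^{-1}\}-1/(n_1+n_2)$, the oracle weights are feasible, the balancing optimization has a solution, and every solution $\widehat{\boldsymbol W}$ satisfies $$\sup_{\|\boldsymbol\Delta\|_{\max}\le\beta'}S(\widehat{\boldsymbol W},\boldsymbol\Delta)\ \le\ C\,\beta'^2\min\left\{\frac{\log^{1/2}(n_1+n_2)}{\sqrt{\pi_L(n_1\wedge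 n_2)}},\ \frac{\sqrt{n_1+n_2}}{\pi_L\sqrt{n_1n_2}}\right\}.$$ -/

import Mathlib

open MeasureTheory ProbabilityTheory
open scoped Matrix

noncomputable section

namespace MatrixBalancing

/-- The spectral norm `‖A‖` of a real rectangular matrix: the operator norm of `x ↦ A x` between
Euclidean spaces. -/
def spectralNorm {n₁ n₂ : ℕ} (A : Matrix (Fin n₁) (Fin n₂) ℝ) : ℝ :=
  ‖LinearMap.toContinuousLinearMap (Matrix.toEuclideanLin A)‖

/-- The Frobenius norm `‖A‖_F`. -/
def frobNorm {n₁ n₂ : ℕ} (A : Matrix (Fin n₁) (Fin n₂) ℝ) : ℝ :=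
  Real.sqrt (∑ i, ∑ j, A i j ^ 2)

/-- The norm `‖U‖_{2,∞}`: the largest Euclidean length of a row of `U`. -/
def rowNorm {n k : ℕ} (U : Matrix (Fin n) (Fin k) ℝ) : ℝ :=
  ⨆ i, Real.sqrt (∑ l, U i l ^ 2)

/-- The max norm `‖C‖_max`: the infimum of `‖U‖_{2,∞} ‖V‖_{2,∞}` over all factorizations
`C = U Vᵀ`, with an arbitrary inner dimension. -/
def maxNorm {n₁ n₂ : ℕ} (C : Matrix (Fin n₁) (Fin n₂) ℝ) : ℝ :=
  sInf {r : ℝ | ∃ (k : ℕ) (U : Matrix (Fin n₁) (Fin k) ℝ) (V : Matrix (Fin n₂) (Fin k) ℝ),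
    C = U * Vᵀ ∧ r = rowNorm U * rowNorm V}

/-- The matrix `J` of ones. -/
def onesMatrix (n₁ n₂ : ℕ) : Matrix (Fin n₁) (Fin n₂) ℝ := Matrix.of fun _ _ => 1

/-- The oracle weights, the entrywise reciprocals of the observation probabilities. -/
def oracleWeights {n₁ n₂ : ℕ} (p : Matrix (Fin n₁) (Fin n₂) ℝ) : Matrix (Fin n₁) (Fin n₂) ℝ :=
  Matrix.of fun i j => (p i j)⁻¹

/-- The balancing error `S(W, Δ) = (n₁ n₂)⁻¹ |⟨Δ, (T ∘ W - J) ∘ Δ⟩|` for the indicators `T`, where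
`∘` is the entrywise product and `⟨A, B⟩ = ∑ A_ij B_ij`. -/
def balancingError {n₁ n₂ : ℕ} (T W D : Matrix (Fin n₁) (Fin n₂) ℝ) : ℝ :=
  ((n₁ : ℝ) * n₂)⁻¹ * |∑ i, ∑ j, D i j * ((T ⊙ W - onesMatrix n₁ n₂) ⊙ D) i j|

/-- The feasible set of the balancing optimization, `‖T ∘ W‖_F ≤ κ` and `W_ij ≥ 1`. -/
def feasibleWeights {n₁ n₂ : ℕ} (T : Matrix (Fin n₁) (Fin n₂) ℝ) (κ : ℝ) :
    Set (Matrix (Fin n₁) (Fin n₂) ℝ) :=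
  {W | frobNorm (T ⊙ W) ≤ κ ∧ ∀ i j, 1 ≤ W i j}

/-- `W` solves the balancing optimization: it minimizes `‖T ∘ W - J‖` over the feasible set. -/
def IsBalancingWeights {n₁ n₂ : ℕ} (T : Matrix (Fin n₁) (Fin n₂) ℝ) (κ : ℝ)
    (W : Matrix (Fin n₁) (Fin n₂) ℝ) : Prop :=
  W ∈ feasibleWeights T κ ∧
    IsMinOn (fun W' => spectralNorm (T ⊙ W' - onesMatrix n₁ n₂)) (feasibleWeights T κ) W

/-- The rate `min {log^{1/2}(n₁+n₂) / √(q (n₁ ∧ n₂)), √(n₁+n₂) / (q √(n₁ n₂))}`. -/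
def balancingRate (n₁ n₂ : ℕ) (q : ℝ) : ℝ :=
  min (Real.sqrt (Real.log ((n₁ : ℝ) + n₂)) / Real.sqrt (q * min (n₁ : ℝ) n₂))
    (Real.sqrt ((n₁ : ℝ) + n₂) / (q * Real.sqrt ((n₁ : ℝ) * n₂)))

end MatrixBalancing

end

/-! The max norm is dual enough to the spectral norm: if `D = U * Vᵀ`, then the entrywise square of
`D` factors through the row-wise tensor squares of `U` and `V`, so `balancingError T W D` is at most
`spectralNorm (T ⊙ W - J) * β' ^ 2 / √(n₁ n₂)` (`balancingError_le`). When the oracle weights are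
feasible, optimality replaces the solution by the oracle, and it remains to bound the norm of the
oracle noise, whose entries `T/p - 1` are independent, centred, bounded by `1/pL` and of variance at
most `1/pL`.

Feasibility is a scalar Chernoff bound for `∑ T/p²`, whose mean is `∑ 1/p`
(`measureReal_not_feasible_le`).

The rate `√N/pL`, with `N = n₁ + n₂`, comes from Hoeffding's inequality and a union bound over two
nets (`measureReal_spectralNorm_gt_le`).

The logarithmic rate comes from a matrix Laplace transform
(`measureReal_spectralNorm_gt_le_of_log_le`). Peeling off single entries with Golden–Thompson would
cost a variance factor for each of the `n₁ n₂` entries. Instead the positions are coloured with `max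
n₁ n₂` colours, no two of one colour sharing a row or column; a whole colour class then costs one
factor `1 + v`. This needs `log N ≤ pL * max n₁ n₂`. Otherwise the claimed bound exceeds `√(n₁ n₂)`,
which every solution satisfies by comparison with the feasible weights `J`. -/

namespace MatrixBalancing

/-! ### Trace inequalities for dyadic products of matrices -/

/-- The product of `A 0, …, A (2 ^ k - 1)`, multiplied in adjacent pairs. -/
def dyadicProd {M : Type*} [Mul M] : ℕ → (ℕ → M) → M
  | 0, A => A 0
  | k + 1, A => dyadicProd k fun i => A (2 * i) * A (2 * i + 1)

lemma dyadicProd_const {M : Type*} [Monoid M] (k : ℕ) (a : M) :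
    dyadicProd k (fun _ => a) = a ^ 2 ^ k := by
  induction k generalizing a with
  | zero => simp [dyadicProd]
  | succ k ih => rw [dyadicProd, ih, ← pow_two, ← pow_mul, pow_succ']

lemma dyadicProd_alternate {M : Type*} [Monoid M] (k : ℕ) (a b : M) :
    dyadicProd (k + 1) (fun i => if i % 2 = 0 then a else b) = (a * b) ^ 2 ^ k := by
  rw [dyadicProd, ← dyadicProd_const]
  congr 1
  ext i
  have h : (2 * i + 1) % 2 ≠ 0 := by omega
  simp

section Trace

variable {m : Type*} [Fintype m]

lemma abs_trace_mul_le (A B : Matrix m m ℝ) (t : ℝ) (hA : (Aᵀ * A).trace ≤ t)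
    (hB : (Bᵀ * B).trace ≤ t) : |(A * B).trace| ≤ t := by
  have h2 : ∀ C : Matrix m m ℝ, (Cᵀ * C).trace = ∑ i, ∑ j, C j i ^ 2 := fun C => by
    simp [Matrix.trace, Matrix.mul_apply, pow_two]
  rw [h2] at hA hB
  rw [Finset.sum_comm] at hA
  have h1 : (A * B).trace = ∑ i, ∑ j, A i j * B j i := by
    simp [Matrix.trace, Matrix.mul_apply]
  have h3 : ∑ i, ∑ j, |A i j * B j i| ≤ ∑ i, ∑ j, (A i j ^ 2 + B j i ^ 2) / 2 :=
    Finset.sum_le_sum fun i _ => Finset.sum_le_sum fun j _ => by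
      rw [abs_mul]
      nlinarith [sq_nonneg (|A i j| - |B j i|), sq_abs (A i j), sq_abs (B j i)]
  have h4 : ∑ i, ∑ j, (A i j ^ 2 + B j i ^ 2) / 2 =
      (∑ i, ∑ j, A i j ^ 2 + ∑ i, ∑ j, B j i ^ 2) / 2 := by
    simp only [← Finset.sum_div, Finset.sum_add_distrib]
  rw [h1]
  refine (Finset.abs_sum_le_sum_abs _ _).trans ?_
  refine (Finset.sum_le_sum fun i _ => Finset.abs_sum_le_sum_abs _ _).trans ?_
  linarith

variable [DecidableEq m]

lemma trace_pow_mul_comm (A B : Matrix m m ℝ) (k : ℕ) :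
    ((A * B) ^ k).trace = ((B * A) ^ k).trace := by
  cases k with
  | zero => simp
  | succ k =>
    have h : (A * B) ^ (k + 1) = A * ((B * A) ^ k * B) := by
      rw [pow_succ, ← mul_assoc, ← mul_assoc]
      congr 1
      exact (SemiconjBy.pow_right (a := A) (x := B * A) (y := A * B)
        (by simp [SemiconjBy, mul_assoc]) k).eq.symm
    rw [h, Matrix.trace_mul_comm, mul_assoc, ← pow_succ]

/-- Schatten–Hölder inequality for `2 ^ (k + 1)` factors and exponent `2 ^ (k + 1)`. -/
lemma abs_trace_dyadicProd_le (k : ℕ) (A : ℕ → Matrix m m ℝ) (t : ℝ)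
    (hA : ∀ i, (((A i)ᵀ * A i) ^ 2 ^ k).trace ≤ t) : |(dyadicProd (k + 1) A).trace| ≤ t := by
  induction k generalizing A with
  | zero =>
    simp only [pow_zero, pow_one] at hA
    exact abs_trace_mul_le _ _ t (hA 0) (hA 1)
  | succ k ih =>
    -- The induction hypothesis is used twice: on the products of adjacent pairs, and then on the
    -- word `PQPQ…` to which cyclicity of the trace reduces each pair.
    rw [dyadicProd]
    apply ih
    intro i
    set P := (A (2 * i))ᵀ * A (2 * i) with hP
    set Q := A (2 * i + 1) * (A (2 * i + 1))ᵀ with hQ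
    have hPt : Pᵀ = P := by simp [hP]
    have hQt : Qᵀ = Q := by simp [hQ]
    have h1 : (A (2 * i) * A (2 * i + 1))ᵀ * (A (2 * i) * A (2 * i + 1)) =
        (A (2 * i + 1))ᵀ * (P * A (2 * i + 1)) := by
      simp [hP, Matrix.transpose_mul, mul_assoc]
    rw [h1, trace_pow_mul_comm, mul_assoc, ← hQ, ← dyadicProd_alternate]
    refine (le_abs_self _).trans (ih _ fun j => ?_)
    have h2 : ∀ R : Matrix m m ℝ, (R * R) ^ 2 ^ k = R ^ 2 ^ (k + 1) := fun R => by
      rw [← pow_two, ← pow_mul, pow_succ']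
    split_ifs
    · rw [hPt, h2]; exact hA _
    · rw [hQt, h2, hQ, trace_pow_mul_comm]; exact hA _

/-- Hölder with equal factors gives `tr (AB)^(2^(k+1)) ≤ tr ((AB)ᵀAB)^(2^k)`, and the right side is
`tr (A²B²)^(2^k)` by cyclicity, so the squares of `A` and `B` enter the induction. -/
lemma trace_mul_pow_le (k : ℕ) (A B : Matrix m m ℝ) (hA : Aᵀ = A) (hB : Bᵀ = B) :
    ((A * B) ^ 2 ^ k).trace ≤ (A ^ 2 ^ k * B ^ 2 ^ k).trace := by
  induction k generalizing A B with
  | zero => simp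
  | succ k ih =>
    have h1 := abs_trace_dyadicProd_le k (fun _ => A * B) _ fun _ => le_rfl
    rw [dyadicProd_const] at h1
    refine (le_abs_self _).trans (h1.trans ?_)
    have h2 : (A * B)ᵀ * (A * B) = B * (A ^ 2 * B) := by
      simp [Matrix.transpose_mul, hA, hB, pow_two, mul_assoc]
    rw [h2, trace_pow_mul_comm, mul_assoc, ← pow_two, pow_succ' 2 k, pow_mul, pow_mul]
    exact ih _ _ (by simp [Matrix.transpose_pow, hA]) (by simp [Matrix.transpose_pow, hB])

end Trace

/-! ### The Lie product formula -/

section LieProduct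

open Filter Topology NormedSpace

lemma norm_pow_sub_pow_le {R : Type*} [NormedRing R] [NormOneClass R] (a b : R) (M : ℝ)
    (hM : 1 ≤ M) (ha : ‖a‖ ≤ M) (hb : ‖b‖ ≤ M) (n : ℕ) :
    ‖a ^ n - b ^ n‖ ≤ n * M ^ n * ‖a - b‖ := by
  have hM0 : 0 ≤ M := by linarith
  induction n with
  | zero => simp
  | succ n ih =>
    have h : a ^ (n + 1) - b ^ (n + 1) = a * (a ^ n - b ^ n) + (a - b) * b ^ n := by
      rw [pow_succ', pow_succ']; noncomm_ring
    have h2 : ‖b ^ n‖ ≤ M ^ n := (norm_pow_le b n).trans (by gcongr)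
    have h3 : M ^ n ≤ M ^ (n + 1) := pow_le_pow_right₀ hM n.le_succ
    calc ‖a ^ (n + 1) - b ^ (n + 1)‖
        ≤ ‖a‖ * ‖a ^ n - b ^ n‖ + ‖a - b‖ * ‖b ^ n‖ := by
          rw [h]; exact (norm_add_le _ _).trans (add_le_add (norm_mul_le _ _) (norm_mul_le _ _))
      _ ≤ M * (n * M ^ n * ‖a - b‖) + ‖a - b‖ * M ^ (n + 1) := by
          gcongr
          exact h2.trans h3
      _ = _ := by push_cast; ring

variable {𝔸 : Type*} [NormedRing 𝔸] [NormedAlgebra ℝ 𝔸] [NormOneClass 𝔸]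

lemma norm_exp_le_exp_norm (x : 𝔸) : ‖exp x‖ ≤ Real.exp ‖x‖ := by
  rw [Real.exp_eq_exp_ℝ, exp_eq_tsum ℝ, exp_eq_tsum ℝ]
  refine tsum_of_norm_bounded (expSeries_summable' (𝕂 := ℝ) ‖x‖).hasSum fun n => ?_
  rw [norm_smul, norm_inv, Real.norm_natCast, smul_eq_mul]
  gcongr
  exact norm_pow_le x n

variable [CompleteSpace 𝔸]

/-- The **Lie product formula** in a real Banach algebra. -/
lemma tendsto_exp_mul_exp_pow (X Y : 𝔸) :
    Tendsto (fun n : ℕ => (exp ((n : ℝ)⁻¹ • X) * exp ((n : ℝ)⁻¹ • Y)) ^ n) atTop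
      (𝓝 (exp (X + Y))) := by
  have hexp : ∀ Z : 𝔸, HasDerivAt (fun t : ℝ => exp (t • Z)) Z 0 := fun Z => by
    simpa using hasDerivAt_exp_smul_const (𝕂 := ℝ) Z 0
  -- The two curves agree to first order at `0`, so they differ by `o(1/n)` at time `1/n`;
  -- telescoping the `n`-th powers multiplies this by only `n` and a bounded factor.
  have hder : HasDerivAt (fun t : ℝ => exp (t • X) * exp (t • Y) - exp (t • (X + Y))) 0 0 := by
    have := ((hexp X).mul (hexp Y)).sub (hexp (X + Y))
    convert this using 1
    · rfl
    · rfl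
    · simp
  have hslope : Tendsto (fun n : ℕ => (n : ℝ) * ‖exp ((n : ℝ)⁻¹ • X) * exp ((n : ℝ)⁻¹ • Y)
      - exp ((n : ℝ)⁻¹ • (X + Y))‖) atTop (𝓝 0) := by
    have h1 := hasDerivAt_iff_tendsto_slope_zero.1 hder
    have h2 : Tendsto (fun n : ℕ => ((n : ℝ))⁻¹) atTop (𝓝[≠] 0) := by
      refine tendsto_nhdsWithin_iff.2 ⟨tendsto_inv_atTop_nhds_zero_nat, ?_⟩
      filter_upwards [eventually_gt_atTop 0] with n hn
      have : (n : ℝ) ≠ 0 := by positivity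
      simpa using hn.ne'
    have h3 := (h1.comp h2).norm
    simp only [norm_zero] at h3
    refine h3.congr fun n => ?_
    simp [norm_smul]
  rw [tendsto_iff_norm_sub_tendsto_zero]
  set c := ‖X‖ + ‖Y‖ with hc
  have hlim : Tendsto (fun n : ℕ => Real.exp c * ((n : ℝ) * ‖exp ((n : ℝ)⁻¹ • X) *
      exp ((n : ℝ)⁻¹ • Y) - exp ((n : ℝ)⁻¹ • (X + Y))‖)) atTop (𝓝 0) := by
    simpa using hslope.const_mul (Real.exp c)
  refine squeeze_zero' (Eventually.of_forall fun n => norm_nonneg _) ?_ hlim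
  filter_upwards [eventually_gt_atTop 0] with n hn
  have hn0 : (n : ℝ) ≠ 0 := by positivity
  have hnorm : ∀ Z : 𝔸, ‖exp ((n : ℝ)⁻¹ • Z)‖ ≤ Real.exp ((n : ℝ)⁻¹ * ‖Z‖) := fun Z => by
    refine (norm_exp_le_exp_norm _).trans ?_
    rw [norm_smul, norm_inv, Real.norm_natCast]
  have hE : exp (X + Y) = exp ((n : ℝ)⁻¹ • (X + Y)) ^ n := by
    let : NormedAlgebra ℚ 𝔸 := .restrictScalars ℚ ℝ 𝔸
    rw [← exp_nsmul, ← Nat.cast_smul_eq_nsmul ℝ, smul_smul, mul_inv_cancel₀ hn0, one_smul]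
  rw [hE]
  have hc0 : 0 ≤ c := by positivity
  refine (norm_pow_sub_pow_le _ _ (Real.exp ((n : ℝ)⁻¹ * c)) ?_ ?_ ?_ n).trans (le_of_eq ?_)
  · exact Real.one_le_exp (by positivity)
  · refine (norm_mul_le _ _).trans ?_
    rw [hc, mul_add, Real.exp_add]
    exact mul_le_mul (hnorm X) (hnorm Y) (norm_nonneg _) (Real.exp_nonneg _)
  · refine (hnorm _).trans (Real.exp_le_exp.2 ?_)
    gcongr
    exact norm_add_le _ _
  · rw [← Real.exp_nat_mul, mul_inv_cancel_left₀ hn0]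
    ring

end LieProduct

/-! ### The Golden–Thompson inequality -/

section GoldenThompson

open Filter Topology NormedSpace

variable {m : Type*} [Fintype m] [DecidableEq m]

open scoped Matrix.Norms.Operator in
/-- The **Golden–Thompson inequality** for real symmetric matrices. -/
lemma trace_exp_add_le (X Y : Matrix m m ℝ) (hX : X.IsSymm) (hY : Y.IsSymm) :
    (exp (X + Y)).trace ≤ (exp X * exp Y).trace := by
  cases isEmpty_or_nonempty m
  · simp [Matrix.trace]
  -- The Lie formula is needed only along `n = 2 ^ k`, where `trace_mul_pow_le` applies.
  have h2 : Tendsto (fun k : ℕ => 2 ^ k) atTop atTop :=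
    tendsto_pow_atTop_atTop_of_one_lt one_lt_two
  have h1 := (tendsto_exp_mul_exp_pow X Y).comp h2
  have h3 := (Continuous.tendsto (f := fun M : Matrix m m ℝ => M.trace) (by fun_prop) _).comp h1
  refine le_of_tendsto' h3 fun k => ?_
  have hpow : ∀ Z : Matrix m m ℝ, exp ((((2 ^ k : ℕ) : ℝ))⁻¹ • Z) ^ 2 ^ k = exp Z := fun Z => by
    rw [← Matrix.exp_nsmul, ← Nat.cast_smul_eq_nsmul ℝ, smul_smul, mul_inv_cancel₀ (by positivity),
      one_smul]
  have := trace_mul_pow_le k (exp ((((2 ^ k : ℕ) : ℝ))⁻¹ • X)) (exp ((((2 ^ k : ℕ) : ℝ))⁻¹ • Y))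
    (hX.smul _).exp (hY.smul _).exp
  rwa [hpow, hpow] at this

end GoldenThompson

/-! ### Trace exponentials of symmetric matrices -/

section Spectral

open NormedSpace

variable {m : Type*} [Fintype m] [DecidableEq m]

lemma exists_orthogonal_diagonalization {S : Matrix m m ℝ} (hS : S.IsSymm) :
    ∃ (U : Matrix m m ℝ) (d : m → ℝ), Uᵀ * U = 1 ∧ U * Uᵀ = 1 ∧
      S = U * Matrix.diagonal d * Uᵀ := by
  have hH : S.IsHermitian := by
    rw [Matrix.IsHermitian, Matrix.conjTranspose_eq_transpose_of_trivial]; exact hS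
  refine ⟨hH.eigenvectorUnitary, hH.eigenvalues, ?_, ?_, ?_⟩
  · rw [← Matrix.conjTranspose_eq_transpose_of_trivial, ← Matrix.star_eq_conjTranspose]
    exact Unitary.coe_star_mul_self hH.eigenvectorUnitary
  · rw [← Matrix.conjTranspose_eq_transpose_of_trivial, ← Matrix.star_eq_conjTranspose]
    exact Unitary.coe_mul_star_self hH.eigenvectorUnitary
  · have := hH.spectral_theorem
    rw [Unitary.conjStarAlgAut_apply, Matrix.star_eq_conjTranspose,
      Matrix.conjTranspose_eq_transpose_of_trivial] at this
    exact this

lemma exp_orthogonal_conj {U : Matrix m m ℝ} (hU : U * Uᵀ = 1) (d : m → ℝ) :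
    exp (U * Matrix.diagonal d * Uᵀ) = U * Matrix.diagonal (fun i => Real.exp (d i)) * Uᵀ := by
  have hinv : U⁻¹ = Uᵀ := Matrix.inv_eq_right_inv hU
  have hunit : IsUnit U := (Matrix.isUnit_iff_isUnit_det U).2
    (Matrix.isUnit_det_of_right_inverse hU)
  rw [← hinv, Matrix.exp_conj _ _ hunit, Matrix.exp_diagonal]
  congr 3
  ext i
  rw [Pi.coe_exp, Real.exp_eq_exp_ℝ]

lemma posSemidef_exp {S : Matrix m m ℝ} (hS : S.IsSymm) : (exp S).PosSemidef := by
  have h : exp S = (exp ((2 : ℝ)⁻¹ • S))ᴴ * exp ((2 : ℝ)⁻¹ • S) := by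
    rw [Matrix.conjTranspose_eq_transpose_of_trivial, (hS.smul _).exp,
      ← Matrix.exp_add_of_commute _ _ (Commute.refl _), ← add_smul]
    norm_num
  rw [h]
  exact Matrix.posSemidef_conjTranspose_mul_self _

/-- The contraction hypothesis puts the eigenvalues of `Y` in `[-1, 1]`, where `e^d ≤ 1 + d + d²`;
in an eigenbasis of `Y` these inequalities are weighted by the nonnegative diagonal of `P`. -/
lemma trace_mul_exp_le {P Y : Matrix m m ℝ} (hP : P.PosSemidef) (hY : Y.IsSymm)
    (hle : ∀ v : m → ℝ, (Y *ᵥ v) ⬝ᵥ (Y *ᵥ v) ≤ v ⬝ᵥ v) :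
    (P * exp Y).trace ≤ (P * (1 + Y + Y * Y)).trace := by
  obtain ⟨U, d, h1, h2, h3⟩ := exists_orthogonal_diagonalization hY
  have hd : ∀ i, |d i| ≤ 1 := fun i => by
    have hv : ∀ e : m → ℝ, (U *ᵥ e) ⬝ᵥ (U *ᵥ e) = e ⬝ᵥ e := fun e => by
      rw [Matrix.dotProduct_mulVec, ← Matrix.mulVec_transpose, Matrix.mulVec_mulVec, h1,
        Matrix.one_mulVec]
    have := hle (U *ᵥ Pi.single i 1)
    rw [h3, Matrix.mulVec_mulVec, mul_assoc, h1, mul_one, ← Matrix.mulVec_mulVec, hv, hv] at this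
    simp at this
    exact abs_le_one_iff_mul_self_le_one.2 this
  have hpoly : 1 + Y + Y * Y = U * Matrix.diagonal (fun i => 1 + d i + d i * d i) * Uᵀ := by
    have hsq : Y * Y = U * Matrix.diagonal (fun i => d i * d i) * Uᵀ := by
      rw [← Matrix.diagonal_mul_diagonal, h3]
      calc U * Matrix.diagonal d * Uᵀ * (U * Matrix.diagonal d * Uᵀ)
          = U * Matrix.diagonal d * (Uᵀ * U) * (Matrix.diagonal d * Uᵀ) := by
            simp only [mul_assoc]
        _ = _ := by rw [h1]; simp only [mul_assoc, mul_one]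
    have hone : (1 : Matrix m m ℝ) = U * Matrix.diagonal (fun _ => 1) * Uᵀ := by simp [h2]
    rw [hsq, ← Matrix.diagonal_add, ← Matrix.diagonal_add, mul_add, mul_add, add_mul, add_mul,
      ← hone, ← h3]
  have htr : ∀ e : m → ℝ, (P * (U * Matrix.diagonal e * Uᵀ)).trace =
      ∑ i, (Uᵀ * P * U) i i * e i := fun e => by
    rw [← mul_assoc, Matrix.trace_mul_comm, ← mul_assoc, ← mul_assoc]
    simp [Matrix.trace, Matrix.mul_diagonal]
  have hdiag : ∀ i, 0 ≤ (Uᵀ * P * U) i i := fun i => by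
    have := (hP.conjTranspose_mul_mul_same U).diag_nonneg (i := i)
    rwa [Matrix.conjTranspose_eq_transpose_of_trivial] at this
  rw [hpoly, htr, h3, exp_orthogonal_conj h2, htr]
  refine Finset.sum_le_sum fun i _ => mul_le_mul_of_nonneg_left ?_ (hdiag i)
  have := (abs_le.1 (Real.abs_exp_sub_one_sub_id_le (hd i))).2
  nlinarith

/-- Jensen's inequality for the probability weights `z i ^ 2`, the squared coordinates of `w` in an
eigenbasis. -/
lemma exp_dotProduct_mulVec_le_trace_exp {S : Matrix m m ℝ} (hS : S.IsSymm) {w : m → ℝ}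
    (hw : w ⬝ᵥ w = 1) : Real.exp (w ⬝ᵥ S *ᵥ w) ≤ (exp S).trace := by
  obtain ⟨U, d, h1, h2, h3⟩ := exists_orthogonal_diagonalization hS
  set z := Uᵀ *ᵥ w with hz
  have hz1 : ∑ i, z i ^ 2 = 1 := by
    have : z ⬝ᵥ z = 1 := by
      rw [hz, Matrix.dotProduct_mulVec, ← Matrix.mulVec_transpose, Matrix.mulVec_mulVec,
        Matrix.transpose_transpose, h2, Matrix.one_mulVec, hw]
    simpa [dotProduct, pow_two] using this
  have hq : w ⬝ᵥ S *ᵥ w = ∑ i, z i ^ 2 • d i := by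
    rw [h3, ← Matrix.mulVec_mulVec, ← hz, ← Matrix.mulVec_mulVec, Matrix.dotProduct_mulVec,
      ← Matrix.mulVec_transpose, ← hz]
    simp [dotProduct, Matrix.mulVec_diagonal, pow_two]
    exact Finset.sum_congr rfl fun i _ => by ring
  have ht : (exp S).trace = ∑ i, Real.exp (d i) := by
    rw [h3, exp_orthogonal_conj h2, mul_assoc, Matrix.trace_mul_comm, mul_assoc, h1, mul_one,
      Matrix.trace_diagonal]
  rw [hq, ht]
  refine (convexOn_exp.map_sum_le (fun i _ => sq_nonneg _) hz1 fun i _ => Set.mem_univ _).trans ?_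
  refine Finset.sum_le_sum fun i _ => ?_
  rw [smul_eq_mul]
  have hzi : z i ^ 2 ≤ 1 := hz1 ▸ Finset.single_le_sum (f := fun i => z i ^ 2)
    (fun i _ => sq_nonneg _) (Finset.mem_univ i)
  nlinarith [Real.exp_pos (d i)]

end Spectral

/-! ### The matrix Laplace transform by colour classes -/

section LaplaceTransform

open NormedSpace

variable {Ω ι κ m : Type*} [MeasurableSpace Ω] {μ : Measure Ω} [Fintype ι] [Fintype m]
  [DecidableEq m]

lemma integrable_continuous_comp_of_bounded [IsFiniteMeasure μ] {x : ι → Ω → ℝ}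
    (hx : ∀ e, Measurable (x e))
    {b : ℝ} (hb : ∀ e ω, |x e ω| ≤ b) {G : (ι → ℝ) → ℝ} (hG : Continuous G) :
    Integrable (fun ω => G fun e => x e ω) μ := by
  have hK : IsCompact (Set.univ.pi fun _ : ι => Set.Icc (-b) b) :=
    isCompact_univ_pi fun _ => isCompact_Icc
  obtain ⟨C, hC⟩ := hK.exists_bound_of_continuousOn hG.continuousOn
  refine Integrable.of_bound (hG.measurable.comp (measurable_pi_lambda _ hx)).aestronglyMeasurable
    C (Filter.Eventually.of_forall fun ω => hC _ fun e _ => abs_le.1 (hb e ω))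

open scoped Matrix.Norms.Operator in
lemma continuous_trace_exp_mul {α : Type*} [TopologicalSpace α] {f : α → Matrix m m ℝ}
    (hf : Continuous f) (A : Matrix m m ℝ) : Continuous fun z => (exp (f z) * A).trace := by
  have h : Continuous fun z => exp (f z) :=
    (exp_continuous (𝔸 := Matrix m m ℝ)).comp hf
  have h2 : Continuous fun M : Matrix m m ℝ => (M * A).trace := by fun_prop
  exact h2.comp h

lemma integral_mul_trace_exp {x : ι → Ω → ℝ} (hx : ∀ e, Measurable (x e))
    (hind : iIndepFun x μ) (B : ι → Matrix m m ℝ) (A : Matrix m m ℝ) (s : Finset ι) {e : ι}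
    (he : e ∉ s) {g : ℝ → ℝ} (hg : Measurable g) :
    ∫ ω, g (x e ω) * (exp (∑ i ∈ s, x i ω • B i) * A).trace ∂μ =
      (∫ ω, g (x e ω) ∂μ) * ∫ ω, (exp (∑ i ∈ s, x i ω • B i) * A).trace ∂μ := by
  have h1 := hind.indepFun_finset {e} s (by simpa using he) hx
  have hF : Measurable fun z : s → ℝ => (exp (∑ i, z i • B i) * A).trace :=
    (continuous_trace_exp_mul (by fun_prop) A).measurable
  have hG : Measurable fun z : ({e} : Finset ι) → ℝ => g (z ⟨e, Finset.mem_singleton_self e⟩) :=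
    hg.comp (measurable_pi_apply _)
  have h2 := h1.comp hG hF
  have h3 : ∀ ω, (exp (∑ i ∈ s, x i ω • B i) * A).trace =
      (exp (∑ i : s, x i ω • B i) * A).trace := fun ω => by
    rw [Finset.sum_coe_sort s fun i => x i ω • B i]
  simp only [h3]
  refine h2.integral_fun_mul_eq_mul_integral ?_ ?_
  · exact (hG.comp (measurable_pi_lambda _ fun i => hx _)).aestronglyMeasurable
  · exact (hF.comp (measurable_pi_lambda _ fun i => hx _)).aestronglyMeasurable

variable {x : ι → Ω → ℝ} {B : ι → Matrix m m ℝ} {D : ι → m → ℝ} {v : ℝ}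
  [IsProbabilityMeasure μ] [DecidableEq ι]

/-- Adds one colour class `t`, with sum `Y`. Golden–Thompson separates `exp Y`. The cross products
in `Y²` vanish, so `Y²` is diagonal with entries at most `1` and `trace_mul_exp_le` applies. By
independence from `s`, the linear term has mean zero and the quadratic one contributes at most a
factor `v`. -/
lemma integral_trace_exp_add_le (hx : ∀ e, Measurable (x e)) (hind : iIndepFun x μ)
    (hb : ∀ e ω, |x e ω| ≤ 1) (hmean : ∀ e, ∫ ω, x e ω ∂μ = 0)
    (hv : ∀ e, ∫ ω, x e ω ^ 2 ∂μ ≤ v) (hv0 : 0 ≤ v)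
    (hB : ∀ e, (B e).IsSymm) (hD : ∀ e, B e * B e = Matrix.diagonal (D e))
    (hD0 : ∀ e a, 0 ≤ D e a) (s t : Finset ι) (hst : Disjoint s t)
    (ht : ∀ e ∈ t, ∀ e' ∈ t, e ≠ e' → B e * B e' = 0) (hDt : ∀ a, ∑ e ∈ t, D e a ≤ 1) :
    ∫ ω, (exp (∑ e ∈ s ∪ t, x e ω • B e)).trace ∂μ ≤
      (1 + v) * ∫ ω, (exp (∑ e ∈ s, x e ω • B e)).trace ∂μ := by
  have hsymm : ∀ (u : Finset ι) ω, (∑ e ∈ u, x e ω • B e).IsSymm := fun u ω => by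
    rw [Matrix.IsSymm, Matrix.transpose_sum]
    exact Finset.sum_congr rfl fun e _ => (hB e).smul _
  have hpsd : ∀ ω, (exp (∑ e ∈ s, x e ω • B e)).PosSemidef := fun ω => posSemidef_exp (hsymm s ω)
  have hint : ∀ (u : Finset ι) (A : Matrix m m ℝ) (k : ι → ℕ), Integrable
      (fun ω => (∏ e, x e ω ^ k e) * (exp (∑ e ∈ u, x e ω • B e) * A).trace) μ := fun u A k =>
    integrable_continuous_comp_of_bounded hx hb
      (G := fun z => (∏ e, z e ^ k e) * (exp (∑ e ∈ u, z e • B e) * A).trace)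
      (by
        have := continuous_trace_exp_mul (f := fun z : ι → ℝ => ∑ e ∈ u, z e • B e)
          (by fun_prop) A
        fun_prop)
  have hint0 : ∀ (u : Finset ι) (A : Matrix m m ℝ), Integrable
      (fun ω => (exp (∑ e ∈ u, x e ω • B e) * A).trace) μ := fun u A => by
    simpa using hint u A fun _ => 0
  have hintk : ∀ (u : Finset ι) (A : Matrix m m ℝ) (e : ι) (k : ℕ), Integrable
      (fun ω => x e ω ^ k * (exp (∑ e ∈ u, x e ω • B e) * A).trace) μ := fun u A e k => by
    have := hint u A (Pi.single e k)
    have h : ∀ ω, ∏ e', x e' ω ^ (Pi.single e k : ι → ℕ) e' = x e ω ^ k := fun ω => by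
      rw [Finset.prod_eq_single e] <;> simp +contextual
    simpa only [h] using this
  have hsq : ∀ ω, (∑ e ∈ t, x e ω • B e) * (∑ e ∈ t, x e ω • B e) =
      ∑ e ∈ t, x e ω ^ 2 • Matrix.diagonal (D e) := fun ω => by
    rw [Finset.sum_mul]
    refine Finset.sum_congr rfl fun e he => ?_
    rw [Finset.mul_sum, Finset.sum_eq_single e]
    · rw [smul_mul_smul_comm, hD, pow_two]
    · intro e' he' hne
      rw [smul_mul_smul_comm, ht e he e' he' hne.symm, smul_zero]
    · exact fun h => absurd he h
  have hcontr : ∀ ω (w : m → ℝ), ((∑ e ∈ t, x e ω • B e) *ᵥ w) ⬝ᵥ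
      ((∑ e ∈ t, x e ω • B e) *ᵥ w) ≤ w ⬝ᵥ w := fun ω w => by
    rw [Matrix.dotProduct_mulVec, ← Matrix.mulVec_transpose, hsymm t ω, Matrix.mulVec_mulVec, hsq,
      dotProduct_comm, Matrix.sum_mulVec]
    simp only [dotProduct, Finset.sum_apply, Matrix.smul_mulVec, Pi.smul_apply,
      Matrix.mulVec_diagonal, smul_eq_mul]
    refine Finset.sum_le_sum fun a _ => ?_
    have h1 : ∑ e ∈ t, x e ω ^ 2 * (D e a * w a) = (∑ e ∈ t, x e ω ^ 2 * D e a) * w a := by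
      rw [Finset.sum_mul]; exact Finset.sum_congr rfl fun _ _ => by ring
    have h2 : ∑ e ∈ t, x e ω ^ 2 * D e a ≤ 1 := by
      refine le_trans (Finset.sum_le_sum fun e _ => ?_) (hDt a)
      have := (sq_le_one_iff_abs_le_one _).2 (hb e ω)
      nlinarith [hD0 e a]
    rw [h1]
    nlinarith [mul_self_nonneg (w a)]
  have hpt : ∀ ω, (exp (∑ e ∈ s ∪ t, x e ω • B e)).trace ≤
      (exp (∑ e ∈ s, x e ω • B e) * 1).trace +
      ∑ e ∈ t, x e ω ^ 1 * (exp (∑ e ∈ s, x e ω • B e) * B e).trace +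
      ∑ e ∈ t, x e ω ^ 2 * (exp (∑ e ∈ s, x e ω • B e) * Matrix.diagonal (D e)).trace := fun ω => by
    rw [Finset.sum_union hst]
    refine (trace_exp_add_le _ _ (hsymm s ω) (hsymm t ω)).trans ?_
    refine (trace_mul_exp_le (hpsd ω) (hsymm t ω) (hcontr ω)).trans (le_of_eq ?_)
    rw [hsq, mul_add, mul_add, Matrix.trace_add, Matrix.trace_add, Finset.mul_sum, Finset.mul_sum,
      Matrix.trace_sum, Matrix.trace_sum]
    simp only [mul_smul_comm, Matrix.trace_smul, smul_eq_mul, pow_one]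
  have hne : ∀ e ∈ t, e ∉ s := fun e he hs => Finset.disjoint_left.1 hst hs he
  have hmono := integral_mono (μ := μ) (by simpa using hint0 (s ∪ t) 1)
    (((hint0 s 1).add (integrable_finsetSum t fun e _ => hintk s (B e) e 1)).add
      (integrable_finsetSum t fun e _ => hintk s (Matrix.diagonal (D e)) e 2)) hpt
  refine hmono.trans ?_
  simp only [Pi.add_apply]
  rw [integral_add, integral_add, integral_finsetSum, integral_finsetSum]
  rotate_left
  · exact fun e _ => hintk s (Matrix.diagonal (D e)) e 2
  · exact fun e _ => hintk s (B e) e 1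
  · exact hint0 s 1
  · exact integrable_finsetSum t fun e _ => hintk s (B e) e 1
  · exact (hint0 s 1).add (integrable_finsetSum t fun e _ => hintk s (B e) e 1)
  · exact integrable_finsetSum t fun e _ => hintk s (Matrix.diagonal (D e)) e 2
  have hzero : ∑ e ∈ t, ∫ ω, x e ω ^ 1 * (exp (∑ e ∈ s, x e ω • B e) * B e).trace ∂μ = 0 :=
    Finset.sum_eq_zero fun e he => by
      rw [integral_mul_trace_exp hx hind B (B e) s (hne e he) (g := fun y => y ^ 1) (by fun_prop)]
      simp [hmean]
  have htrd : ∀ ω e, (exp (∑ e ∈ s, x e ω • B e) * Matrix.diagonal (D e)).trace =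
      ∑ a, exp (∑ e ∈ s, x e ω • B e) a a * D e a := fun ω e => by
    simp [Matrix.trace, Matrix.mul_diagonal]
  have hquad : ∑ e ∈ t, ∫ ω, x e ω ^ 2 *
      (exp (∑ e ∈ s, x e ω • B e) * Matrix.diagonal (D e)).trace ∂μ ≤
      v * ∫ ω, (exp (∑ e ∈ s, x e ω • B e)).trace ∂μ := by
    calc ∑ e ∈ t, ∫ ω, x e ω ^ 2 *
          (exp (∑ e ∈ s, x e ω • B e) * Matrix.diagonal (D e)).trace ∂μ
        ≤ ∑ e ∈ t, v * ∫ ω, (exp (∑ e ∈ s, x e ω • B e) * Matrix.diagonal (D e)).trace ∂μ := by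
          refine Finset.sum_le_sum fun e he => ?_
          rw [integral_mul_trace_exp hx hind B _ s (hne e he) (g := fun y => y ^ 2) (by fun_prop)]
          refine mul_le_mul_of_nonneg_right (hv e) (integral_nonneg fun ω => ?_)
          dsimp only [Pi.zero_apply]
          rw [htrd]
          exact Finset.sum_nonneg fun a _ => mul_nonneg (hpsd ω).diag_nonneg (hD0 e a)
      _ = v * ∫ ω, ∑ e ∈ t, (exp (∑ e ∈ s, x e ω • B e) * Matrix.diagonal (D e)).trace ∂μ := by
          rw [← Finset.mul_sum, integral_finsetSum _ fun e _ => hint0 s _]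
      _ ≤ v * ∫ ω, (exp (∑ e ∈ s, x e ω • B e)).trace ∂μ := by
          refine mul_le_mul_of_nonneg_left (integral_mono
            (integrable_finsetSum t fun e _ => hint0 s _) (by simpa using hint0 s 1)
            fun ω => ?_) hv0
          dsimp only
          simp only [htrd]
          rw [Finset.sum_comm]
          refine Finset.sum_le_sum fun a _ => ?_
          rw [← Finset.mul_sum]
          exact mul_le_of_le_one_right (hpsd ω).diag_nonneg (hDt a)
  rw [hzero]
  simp only [mul_one] at hquad ⊢
  linarith

/-- Matrix Laplace transform bound: entries within a colour class multiply to zero, so each of the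
colours contributes a single factor `1 + v`. -/
lemma integral_trace_exp_le [Fintype κ] [DecidableEq κ] (col : ι → κ)
    (hx : ∀ e, Measurable (x e)) (hind : iIndepFun x μ)
    (hb : ∀ e ω, |x e ω| ≤ 1) (hmean : ∀ e, ∫ ω, x e ω ∂μ = 0)
    (hv : ∀ e, ∫ ω, x e ω ^ 2 ∂μ ≤ v) (hv0 : 0 ≤ v)
    (hB : ∀ e, (B e).IsSymm) (hD : ∀ e, B e * B e = Matrix.diagonal (D e))
    (hD0 : ∀ e a, 0 ≤ D e a) (hcol : ∀ e e', col e = col e' → e ≠ e' → B e * B e' = 0)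
    (hDcol : ∀ c a, ∑ e with col e = c, D e a ≤ 1) :
    ∫ ω, (exp (∑ e, x e ω • B e)).trace ∂μ ≤
      (1 + v) ^ Fintype.card κ * (Fintype.card m : ℝ) := by
  have key : ∀ C : Finset κ, ∫ ω, (exp (∑ e with col e ∈ C, x e ω • B e)).trace ∂μ ≤
      (1 + v) ^ C.card * (Fintype.card m : ℝ) := fun C => by
    induction C using Finset.induction_on with
    | empty => simp
    | insert c C hc ih =>
      have hu : (Finset.univ.filter fun e => col e ∈ insert c C) =
          (Finset.univ.filter fun e => col e ∈ C) ∪ Finset.univ.filter fun e => col e = c := by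
        ext e; simp [or_comm]
      rw [hu, Finset.card_insert_of_notMem hc]
      refine (integral_trace_exp_add_le hx hind hb hmean hv hv0 hB hD hD0 _ _ ?_ ?_
        (hDcol c)).trans ?_
      · rw [Finset.disjoint_filter]
        rintro e - h1 rfl
        exact hc h1
      · intro e he e' he' hne
        simp only [Finset.mem_filter, Finset.mem_univ, true_and] at he he'
        exact hcol e e' (he.trans he'.symm) hne
      · rw [pow_succ', mul_assoc]
        exact mul_le_mul_of_nonneg_left ih (by linarith)
  simpa using key Finset.univ

end LaplaceTransform

/-! ### The spectral norm as a bilinear form bound -/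

section SpectralNorm

variable {n₁ n₂ : ℕ}

lemma spectralNorm_nonneg (A : Matrix (Fin n₁) (Fin n₂) ℝ) : 0 ≤ spectralNorm A := norm_nonneg _

lemma inner_toEuclideanLin (A : Matrix (Fin n₁) (Fin n₂) ℝ) (y : EuclideanSpace ℝ (Fin n₁))
    (x : EuclideanSpace ℝ (Fin n₂)) :
    inner ℝ y (Matrix.toEuclideanLin A x) = ∑ i, ∑ j, A i j * (y i * x j) := by
  simp only [PiLp.inner_apply, RCLike.inner_apply, conj_trivial, Matrix.toEuclideanLin,
    Matrix.toLpLin_apply, Matrix.mulVec, dotProduct, Finset.sum_mul]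
  exact Finset.sum_congr rfl fun i _ => Finset.sum_congr rfl fun j _ => by ring

lemma norm_toEuclideanLin_le (A : Matrix (Fin n₁) (Fin n₂) ℝ) (x : EuclideanSpace ℝ (Fin n₂)) :
    ‖Matrix.toEuclideanLin A x‖ ≤ spectralNorm A * ‖x‖ :=
  (LinearMap.toContinuousLinearMap (Matrix.toEuclideanLin A)).le_opNorm x

lemma abs_bilinear_le (A : Matrix (Fin n₁) (Fin n₂) ℝ) (y : Fin n₁ → ℝ) (x : Fin n₂ → ℝ) :
    |∑ i, ∑ j, A i j * (y i * x j)| ≤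
      spectralNorm A * (√(∑ i, y i ^ 2) * √(∑ j, x j ^ 2)) := by
  have h := inner_toEuclideanLin A (WithLp.toLp 2 y) (WithLp.toLp 2 x)
  have hy : ‖(WithLp.toLp 2 y : EuclideanSpace ℝ (Fin n₁))‖ = √(∑ i, y i ^ 2) := by
    simp [EuclideanSpace.norm_eq]
  have hx : ‖(WithLp.toLp 2 x : EuclideanSpace ℝ (Fin n₂))‖ = √(∑ i, x i ^ 2) := by
    simp [EuclideanSpace.norm_eq]
  dsimp only at h
  rw [← h, ← hy, ← hx]
  refine (abs_real_inner_le_norm _ _).trans ?_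
  calc _ ≤ ‖(WithLp.toLp 2 y : EuclideanSpace ℝ (Fin n₁))‖ *
        (spectralNorm A * ‖(WithLp.toLp 2 x : EuclideanSpace ℝ (Fin n₂))‖) := by
        gcongr; exact norm_toEuclideanLin_le A _
    _ = _ := by ring

lemma spectralNorm_le_of_inner_le {A : Matrix (Fin n₁) (Fin n₂) ℝ} {t : ℝ} (ht : 0 ≤ t)
    (h : ∀ (y : EuclideanSpace ℝ (Fin n₁)) (x : EuclideanSpace ℝ (Fin n₂)), ‖y‖ = 1 → ‖x‖ = 1 →
      inner ℝ y (Matrix.toEuclideanLin A x) ≤ t) : spectralNorm A ≤ t := by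
  refine ContinuousLinearMap.opNorm_le_of_unit_norm ht fun x hx => ?_
  set z := Matrix.toEuclideanLin A x
  change ‖z‖ ≤ t
  rcases eq_or_ne z 0 with hz | hz
  · rw [hz, norm_zero]; exact ht
  have hz0 : ‖z‖ ≠ 0 := norm_ne_zero_iff.2 hz
  have := h (‖z‖⁻¹ • z) x (by rw [norm_smul, norm_inv, norm_norm, inv_mul_cancel₀ hz0]) hx
  rwa [real_inner_smul_left, real_inner_self_eq_norm_sq, pow_two, inv_mul_cancel_left₀ hz0] at this

lemma spectralNorm_le_of_abs_le_one {A : Matrix (Fin n₁) (Fin n₂) ℝ}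
    (hA : ∀ i j, |A i j| ≤ 1) : spectralNorm A ≤ √((n₁ : ℝ) * n₂) := by
  refine ContinuousLinearMap.opNorm_le_bound _ (Real.sqrt_nonneg _) fun x => ?_
  have h1 : ∀ i, (Matrix.toEuclideanLin A x i) ^ 2 ≤ n₂ * ‖x‖ ^ 2 := fun i => by
    have : Matrix.toEuclideanLin A x i = ∑ j, A i j * x j := by
      simp [Matrix.toEuclideanLin, Matrix.toLpLin_apply, Matrix.mulVec, dotProduct]
    rw [this, EuclideanSpace.real_norm_sq_eq]
    refine (Finset.sum_mul_sq_le_sq_mul_sq _ _ _).trans ?_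
    gcongr
    calc ∑ j, A i j ^ 2 ≤ ∑ _j : Fin n₂, (1 : ℝ) :=
          Finset.sum_le_sum fun j _ => (sq_le_one_iff_abs_le_one _).2 (hA i j)
      _ = n₂ := by simp
  change ‖Matrix.toEuclideanLin A x‖ ≤ _
  refine le_of_sq_le_sq ?_ (by positivity)
  rw [EuclideanSpace.real_norm_sq_eq, mul_pow, Real.sq_sqrt (by positivity), mul_assoc]
  refine (Finset.sum_le_sum fun i _ => h1 i).trans ?_
  simp

end SpectralNorm

/-! ### Duality with the max norm -/

section MaxNorm

variable {n₁ n₂ : ℕ}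

lemma rowNorm_nonneg {n k : ℕ} (U : Matrix (Fin n) (Fin k) ℝ) : 0 ≤ rowNorm U :=
  Real.iSup_nonneg fun _ => Real.sqrt_nonneg _

lemma sum_row_sq_le {n k : ℕ} (U : Matrix (Fin n) (Fin k) ℝ) (i : Fin n) :
    ∑ l, U i l ^ 2 ≤ rowNorm U ^ 2 :=
  (Real.sqrt_le_left (rowNorm_nonneg U)).1
    (le_ciSup (f := fun i => √(∑ l, U i l ^ 2)) (Set.finite_range _).bddAbove i)

lemma sum_sq_mul_sq_le {n k : ℕ} (U : Matrix (Fin n) (Fin k) ℝ) :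
    ∑ q : Fin k × Fin k, ∑ i, (U i q.1 * U i q.2) ^ 2 ≤ n * (rowNorm U ^ 2) ^ 2 := by
  rw [Finset.sum_comm]
  have h : ∀ i, ∑ q : Fin k × Fin k, (U i q.1 * U i q.2) ^ 2 ≤ (rowNorm U ^ 2) ^ 2 := fun i => by
    have : ∑ q : Fin k × Fin k, (U i q.1 * U i q.2) ^ 2 = (∑ l, U i l ^ 2) ^ 2 := by
      rw [pow_two (∑ l, U i l ^ 2), Finset.sum_mul_sum, Fintype.sum_prod_type]
      simp only [mul_pow]
    rw [this]
    have := sum_row_sq_le U i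
    gcongr
  refine (Finset.sum_le_sum fun i _ => h i).trans ?_
  simp

/-- Squaring `∑ l, U i l * V j l` gives a sum over pairs `q` of rank-one matrices. Each is paired
with `A` through the spectral norm, and Cauchy–Schwarz over `q` leaves the Frobenius norms of the
tensor squares. -/
lemma abs_sum_mul_sq_le (A : Matrix (Fin n₁) (Fin n₂) ℝ) {k : ℕ} (U : Matrix (Fin n₁) (Fin k) ℝ)
    (V : Matrix (Fin n₂) (Fin k) ℝ) :
    |∑ i, ∑ j, A i j * (U * Vᵀ) i j ^ 2| ≤
      spectralNorm A * √((n₁ : ℝ) * n₂) * (rowNorm U * rowNorm V) ^ 2 := by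
  have h1 : ∑ i, ∑ j, A i j * (U * Vᵀ) i j ^ 2 = ∑ q : Fin k × Fin k, ∑ i, ∑ j,
      A i j * ((U i q.1 * U i q.2) * (V j q.1 * V j q.2)) := by
    symm
    rw [Finset.sum_comm]
    refine Finset.sum_congr rfl fun i _ => ?_
    rw [Finset.sum_comm]
    refine Finset.sum_congr rfl fun j _ => ?_
    rw [← Finset.mul_sum, Fintype.sum_prod_type, Matrix.mul_apply, pow_two, Finset.sum_mul_sum]
    congr 1
    refine Finset.sum_congr rfl fun l _ => Finset.sum_congr rfl fun l' _ => ?_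
    simp only [Matrix.transpose_apply]
    ring
  rw [h1]
  have hU := sum_sq_mul_sq_le U
  have hV := sum_sq_mul_sq_le V
  have hA := spectralNorm_nonneg A
  calc _ ≤ ∑ q : Fin k × Fin k, |∑ i, ∑ j,
        A i j * ((U i q.1 * U i q.2) * (V j q.1 * V j q.2))| := Finset.abs_sum_le_sum_abs _ _
    _ ≤ ∑ q : Fin k × Fin k, spectralNorm A *
        (√(∑ i, (U i q.1 * U i q.2) ^ 2) * √(∑ j, (V j q.1 * V j q.2) ^ 2)) :=
        Finset.sum_le_sum fun q _ => abs_bilinear_le A _ _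
    _ = spectralNorm A * ∑ q : Fin k × Fin k,
        √(∑ i, (U i q.1 * U i q.2) ^ 2) * √(∑ j, (V j q.1 * V j q.2) ^ 2) := by
        rw [Finset.mul_sum]
    _ ≤ spectralNorm A * (√(∑ q : Fin k × Fin k, ∑ i, (U i q.1 * U i q.2) ^ 2) *
        √(∑ q : Fin k × Fin k, ∑ j, (V j q.1 * V j q.2) ^ 2)) := by
        gcongr
        exact Real.sum_sqrt_mul_sqrt_le _ (fun _ => Finset.sum_nonneg fun _ _ => sq_nonneg _)
          fun _ => Finset.sum_nonneg fun _ _ => sq_nonneg _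
    _ ≤ spectralNorm A * (√(n₁ * (rowNorm U ^ 2) ^ 2) * √(n₂ * (rowNorm V ^ 2) ^ 2)) := by
        gcongr
    _ = _ := by
        rw [Real.sqrt_mul (Nat.cast_nonneg _), Real.sqrt_mul (Nat.cast_nonneg _),
          Real.sqrt_mul (Nat.cast_nonneg _), Real.sqrt_sq (sq_nonneg _), Real.sqrt_sq (sq_nonneg _)]
        ring

/-- Duality between the spectral norm and the max norm. -/
lemma balancingError_le {T W D : Matrix (Fin n₁) (Fin n₂) ℝ} {b : ℝ} (hD : maxNorm D ≤ b) :
    balancingError T W D ≤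
      ((n₁ : ℝ) * n₂)⁻¹ * (spectralNorm (T ⊙ W - onesMatrix n₁ n₂) * √((n₁ : ℝ) * n₂) * b ^ 2) := by
  unfold balancingError
  gcongr
  set A := T ⊙ W - onesMatrix n₁ n₂
  have hsum : ∑ i, ∑ j, D i j * (A ⊙ D) i j = ∑ i, ∑ j, A i j * D i j ^ 2 :=
    Finset.sum_congr rfl fun i _ => Finset.sum_congr rfl fun j _ => by
      rw [Matrix.hadamard_apply]; ring
  rw [hsum]
  set c := spectralNorm A * √((n₁ : ℝ) * n₂) with hc
  have hc0 : 0 ≤ c := mul_nonneg (spectralNorm_nonneg A) (Real.sqrt_nonneg _)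
  have hne : {r : ℝ | ∃ (k : ℕ) (U : Matrix (Fin n₁) (Fin k) ℝ) (V : Matrix (Fin n₂) (Fin k) ℝ),
      D = U * Vᵀ ∧ r = rowNorm U * rowNorm V}.Nonempty :=
    ⟨_, n₂, D, 1, by simp, rfl⟩
  -- Attainment of the infimum is avoided by using a factorization of cost below `b + ε` and letting
  -- `ε` tend to `0`.
  have hlim : Filter.Tendsto (fun ε : ℝ => c * (b + ε) ^ 2) (nhdsWithin 0 (Set.Ioi 0))
      (nhds (c * b ^ 2)) := by
    have : Continuous fun ε : ℝ => c * (b + ε) ^ 2 := by fun_prop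
    simpa using (this.tendsto 0).mono_left nhdsWithin_le_nhds
  refine ge_of_tendsto hlim ?_
  filter_upwards [self_mem_nhdsWithin] with ε hε
  obtain ⟨r, ⟨k, U, V, hUV, rfl⟩, hr⟩ := exists_lt_of_csInf_lt hne
    (show maxNorm D < b + ε by linarith [Set.mem_Ioi.1 hε])
  rw [hUV]
  refine (abs_sum_mul_sq_le A U V).trans ?_
  have := mul_nonneg (rowNorm_nonneg U) (rowNorm_nonneg V)
  rw [← hc]
  gcongr

end MaxNorm

/-! ### Nets in Euclidean balls -/

section Net

/-- A `1`-separated subset of the ball of radius `2` has at most `5 ^ d` points, so one of largest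
cardinality exists, and any point farther than `1` from it could be added. -/
lemma exists_finset_net (E : Type*) [NormedAddCommGroup E] [NormedSpace ℝ E]
    [FiniteDimensional ℝ E] : ∃ s : Finset E, s.card ≤ 5 ^ Module.finrank ℝ E ∧
      (∀ c ∈ s, ‖c‖ ≤ 2) ∧ ∀ x : E, ‖x‖ ≤ 2 → ∃ c ∈ s, ‖x - c‖ ≤ 1 := by
  classical
  let P : ℕ → Prop := fun k => ∃ s : Finset E, s.card = k ∧ (∀ c ∈ s, ‖c‖ ≤ 2) ∧
    ∀ c ∈ s, ∀ d ∈ s, c ≠ d → 1 ≤ ‖c - d‖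
  have hP0 : P 0 := ⟨∅, by simp⟩
  have hbd : ∀ k, P k → k ≤ 5 ^ Module.finrank ℝ E := by
    rintro k ⟨s, rfl, h1, h2⟩
    exact Besicovitch.card_le_of_separated s h1 h2
  have hmax : P (Nat.findGreatest P (5 ^ Module.finrank ℝ E)) :=
    Nat.findGreatest_spec (Nat.zero_le _) hP0
  obtain ⟨s, hs, h1, h2⟩ := hmax
  refine ⟨s, hs.le.trans (Nat.findGreatest_le _), h1, fun x hx => ?_⟩
  by_contra! hcon
  have hxs : x ∉ s := fun h => by
    have := hcon x h
    simp at this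
    linarith
  have hP : P (s.card + 1) := by
    refine ⟨insert x s, Finset.card_insert_of_notMem hxs, ?_, ?_⟩
    · simpa [hx] using h1
    · intro c hc d hd hne
      rw [Finset.mem_insert] at hc hd
      rcases hc with rfl | hc <;> rcases hd with rfl | hd
      · exact absurd rfl hne
      · exact (hcon d hd).le
      · rw [norm_sub_rev]; exact (hcon c hc).le
      · exact h2 c hc d hd hne
  have := Nat.le_findGreatest (hbd _ hP) hP
  omega

/-- Radius `2` with mesh `1` loses no constant: approximating twice the unit vector along `A d`
gives `2‖A d‖ ≤ t + ‖A d‖`, and approximating `2x` gives `2‖A x‖ ≤ t + ‖A‖`. -/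
lemma spectralNorm_le_of_net {n₁ n₂ : ℕ} {A : Matrix (Fin n₁) (Fin n₂) ℝ} {t : ℝ} (ht : 0 ≤ t)
    {s₁ : Finset (EuclideanSpace ℝ (Fin n₁))} {s₂ : Finset (EuclideanSpace ℝ (Fin n₂))}
    (h₁ : ∀ x, ‖x‖ ≤ 2 → ∃ c ∈ s₁, ‖x - c‖ ≤ 1) (h₂ : ∀ x, ‖x‖ ≤ 2 → ∃ c ∈ s₂, ‖x - c‖ ≤ 1)
    (h : ∀ c ∈ s₁, ∀ d ∈ s₂, inner ℝ c (Matrix.toEuclideanLin A d) ≤ t) :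
    spectralNorm A ≤ t := by
  have hd : ∀ d ∈ s₂, ‖Matrix.toEuclideanLin A d‖ ≤ t := fun d hd => by
    set z := Matrix.toEuclideanLin A d
    rcases eq_or_ne z 0 with hz | hz
    · rw [hz, norm_zero]; exact ht
    have hz0 : ‖z‖ ≠ 0 := norm_ne_zero_iff.2 hz
    obtain ⟨c, hc, hcn⟩ := h₁ ((2 * ‖z‖⁻¹) • z) (by
      rw [norm_smul, norm_mul, norm_inv, norm_norm, mul_assoc, inv_mul_cancel₀ hz0]; norm_num)
    have e1 : inner ℝ ((2 * ‖z‖⁻¹) • z) z = 2 * ‖z‖ := by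
      rw [real_inner_smul_left, real_inner_self_eq_norm_sq]
      field_simp
    have e2 := real_inner_le_norm ((2 * ‖z‖⁻¹) • z - c) z
    rw [inner_sub_left, e1] at e2
    have e3 := h c hc d hd
    have e4 : ‖(2 * ‖z‖⁻¹) • z - c‖ * ‖z‖ ≤ 1 * ‖z‖ := by gcongr
    linarith
  have hhalf : spectralNorm A ≤ t / 2 + spectralNorm A / 2 := by
    refine ContinuousLinearMap.opNorm_le_of_unit_norm
      (by have := spectralNorm_nonneg A; positivity) fun x hx => ?_
    change ‖Matrix.toEuclideanLin A x‖ ≤ _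
    obtain ⟨d, hds, hdn⟩ := h₂ ((2 : ℝ) • x) (by rw [norm_smul, hx]; norm_num)
    have e1 : (2 : ℝ) • Matrix.toEuclideanLin A x =
        Matrix.toEuclideanLin A d + Matrix.toEuclideanLin A ((2 : ℝ) • x - d) := by
      rw [map_sub, map_smul]; abel
    have e2 := norm_add_le (Matrix.toEuclideanLin A d) (Matrix.toEuclideanLin A ((2 : ℝ) • x - d))
    rw [← e1, norm_smul, Real.norm_ofNat] at e2
    have e3 := norm_toEuclideanLin_le A ((2 : ℝ) • x - d)
    have e4 : spectralNorm A * ‖(2 : ℝ) • x - d‖ ≤ spectralNorm A * 1 :=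
      mul_le_mul_of_nonneg_left hdn (spectralNorm_nonneg A)
    linarith [hd d hds]
  linarith

end Net

/-! ### Bernoulli entries: feasibility of the oracle and the net bound -/

section Bernoulli

variable {Ω : Type*} [MeasurableSpace Ω] {μ : Measure Ω} [IsProbabilityMeasure μ]

lemma integral_comp_bernoulli {t : Ω → ℝ} (ht : Measurable t) (h01 : ∀ ω, t ω = 0 ∨ t ω = 1)
    {q : ℝ} (hq : μ.real {ω | t ω = 1} = q) (g : ℝ → ℝ) :
    ∫ ω, g (t ω) ∂μ = g 0 + (g 1 - g 0) * q := by
  have hms : MeasurableSet {ω | t ω = 1} := ht (measurableSet_singleton 1)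
  have h : ∀ ω, g (t ω) = g 0 + {ω | t ω = 1}.indicator (fun _ => g 1 - g 0) ω := fun ω => by
    rcases h01 ω with h | h <;> simp [Set.indicator, h]
  simp only [h]
  rw [integral_add (integrable_const _) ((integrable_const _).indicator hms),
    integral_indicator_const _ hms, hq]
  simp [mul_comm]

end Bernoulli

section RandomMask

variable {n₁ n₂ : ℕ} {Ω : Type*} [MeasurableSpace Ω] {μ : Measure Ω} [IsProbabilityMeasure μ]
  {T : Ω → Matrix (Fin n₁) (Fin n₂) ℝ} {p : Matrix (Fin n₁) (Fin n₂) ℝ} {pL κ : ℝ}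

/-- The convex function `2 ^ u` lies below its chord on `[0, 1]`. -/
lemma exp_log_two_mul_le {u : ℝ} (h0 : 0 ≤ u) (h1 : u ≤ 1) :
    Real.exp (Real.log 2 * u) ≤ 1 + u := by
  have := rpow_one_add_le_one_add_mul_self (s := 1) (by norm_num) h0 h1
  rw [Real.rpow_def_of_pos (by norm_num)] at this
  norm_num at this
  exact this

lemma oracleWeights_mem_feasibleWeights_of_sum_lt {t : Matrix (Fin n₁) (Fin n₂) ℝ}
    (h01 : ∀ i j, t i j = 0 ∨ t i j = 1) (hp0 : ∀ i j, 0 < p i j) (hp1 : ∀ i j, p i j ≤ 1)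
    (hκ : √(2 * ∑ i, ∑ j, (p i j)⁻¹) ≤ κ)
    (h : ∑ e : Fin n₁ × Fin n₂, (p e.1 e.2 ^ 2)⁻¹ * t e.1 e.2 < 2 * ∑ i, ∑ j, (p i j)⁻¹) :
    oracleWeights p ∈ feasibleWeights t κ := by
  refine ⟨le_trans (Real.sqrt_le_sqrt ?_) hκ, fun i j => (one_le_inv₀ (hp0 i j)).2 (hp1 i j)⟩
  refine le_trans (le_of_eq ?_) h.le
  rw [Fintype.sum_prod_type]
  refine Finset.sum_congr rfl fun i _ => Finset.sum_congr rfl fun j _ => ?_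
  rw [Matrix.hadamard_apply, oracleWeights, Matrix.of_apply]
  rcases h01 i j with h | h <;> simp [h]

lemma measureReal_not_feasible_le (hT : ∀ i j, Measurable fun ω => T ω i j)
    (h01 : ∀ ω i j, T ω i j = 0 ∨ T ω i j = 1)
    (hind : iIndepFun (fun (e : Fin n₁ × Fin n₂) (ω : Ω) => T ω e.1 e.2) μ)
    (hp : ∀ i j, μ.real {ω | T ω i j = 1} = p i j) (hpL : 0 < pL) (hpp : ∀ i j, pL ≤ p i j)
    (hκ : √(2 * ∑ i, ∑ j, (p i j)⁻¹) ≤ κ) :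
    μ.real {ω | oracleWeights p ∉ feasibleWeights (T ω) κ} ≤
      Real.exp (-(2⁻¹ * Real.log 2 * pL ^ 2 * ∑ i, ∑ j, (p i j)⁻¹)) := by
  have hp0 : ∀ i j, 0 < p i j := fun i j => hpL.trans_le (hpp i j)
  have hp1 : ∀ i j, p i j ≤ 1 := fun i j => hp i j ▸ measureReal_le_one
  set E := ∑ i, ∑ j, (p i j)⁻¹ with hE
  have hE0 : 0 ≤ E := Finset.sum_nonneg fun i _ => Finset.sum_nonneg fun j _ =>
    inv_nonneg.2 (hp0 i j).le
  set Z : Fin n₁ × Fin n₂ → Ω → ℝ := fun e ω => (p e.1 e.2 ^ 2)⁻¹ * T ω e.1 e.2 with hZ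
  have hZind : iIndepFun Z μ := hind.comp (fun e y => (p e.1 e.2 ^ 2)⁻¹ * y) fun e => by fun_prop
  have hZm : ∀ e, Measurable (Z e) := fun e => (hT e.1 e.2).const_mul _
  have hsub : {ω | oracleWeights p ∉ feasibleWeights (T ω) κ} ⊆
      {ω | 2 * E ≤ (∑ e, Z e) ω} := fun ω hω => by
    by_contra hcon
    refine hω (oracleWeights_mem_feasibleWeights_of_sum_lt (h01 ω) hp0 hp1 hκ ?_)
    simpa [hZ] using hcon
  -- This parameter makes each exponent `log 2 * (pL²/p²)` with `pL²/p² ≤ 1`, the range of the chord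
  -- bound.
  set s := Real.log 2 * pL ^ 2 with hs
  have hlog : 0 < Real.log 2 := Real.log_pos one_lt_two
  have hs0 : 0 ≤ s := by positivity
  have hmgf : ∀ e, mgf (Z e) μ s ≤ Real.exp (pL ^ 2 * (p e.1 e.2)⁻¹) := fun e => by
    have h1 : mgf (Z e) μ s = 1 + (Real.exp (Real.log 2 * (pL ^ 2 / p e.1 e.2 ^ 2)) - 1) *
        p e.1 e.2 := by
      have := integral_comp_bernoulli (hT e.1 e.2) (fun ω => h01 ω e.1 e.2) (hp e.1 e.2)
        (fun y => Real.exp (s * ((p e.1 e.2 ^ 2)⁻¹ * y)))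
      rw [mgf, this]
      simp [hs, div_eq_mul_inv, mul_assoc]
    have h2 : pL ^ 2 / p e.1 e.2 ^ 2 ≤ 1 := by
      have := hp0 e.1 e.2
      rw [div_le_one (by positivity)]
      have := hpp e.1 e.2
      gcongr
    have h3 := exp_log_two_mul_le (by positivity) h2
    have h4 : pL ^ 2 / p e.1 e.2 ^ 2 * p e.1 e.2 = pL ^ 2 * (p e.1 e.2)⁻¹ := by
      have := (hp0 e.1 e.2).ne'
      field_simp
    have h5 : (Real.exp (Real.log 2 * (pL ^ 2 / p e.1 e.2 ^ 2)) - 1) * p e.1 e.2 ≤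
        pL ^ 2 / p e.1 e.2 ^ 2 * p e.1 e.2 := by
      have := hp0 e.1 e.2
      gcongr
      linarith
    rw [h1]
    linarith [Real.add_one_le_exp (pL ^ 2 * (p e.1 e.2)⁻¹)]
  have hint : Integrable (fun ω => Real.exp (s * (∑ e, Z e) ω)) μ := by
    have hb : ∀ (e : Fin n₁ × Fin n₂) ω, |T ω e.1 e.2| ≤ 1 := fun e ω => by
      rcases h01 ω e.1 e.2 with h | h <;> simp [h]
    have := integrable_continuous_comp_of_bounded (μ := μ) (x := fun e ω => T ω e.1 e.2)
      (fun e => hT e.1 e.2) hb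
      (G := fun z => Real.exp (s * ∑ e : Fin n₁ × Fin n₂, (p e.1 e.2 ^ 2)⁻¹ * z e)) (by fun_prop)
    simpa [hZ] using this
  refine (measureReal_mono hsub).trans ((measure_ge_le_exp_mul_mgf _ hs0 hint).trans ?_)
  rw [hZind.mgf_sum hZm]
  have hprod : ∏ e, mgf (Z e) μ s ≤ Real.exp (pL ^ 2 * E) := by
    refine (Finset.prod_le_prod (fun e _ => mgf_nonneg) fun e _ => hmgf e).trans (le_of_eq ?_)
    rw [← Real.exp_sum, ← Finset.mul_sum, Fintype.sum_prod_type]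
  refine (mul_le_mul_of_nonneg_left hprod (Real.exp_nonneg _)).trans ?_
  rw [← Real.exp_add]
  refine Real.exp_le_exp.2 ?_
  have h6 : 0 ≤ pL ^ 2 * E := by positivity
  -- The Chernoff exponent is `-(2 log 2 - 1) * pL² * E`; it beats `-(log 2)/2 * pL² * E` because
  -- `3/2 * log 2 ≥ 1`.
  have h7 : 0 ≤ (3 / 2 * Real.log 2 - 1) * (pL ^ 2 * E) :=
    mul_nonneg (by linarith [Real.log_two_gt_d9]) h6
  rw [hs]
  linarith

lemma oracle_noise_apply (t : Matrix (Fin n₁) (Fin n₂) ℝ) (i : Fin n₁) (j : Fin n₂) :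
    (t ⊙ oracleWeights p - onesMatrix n₁ n₂) i j = (p i j)⁻¹ * t i j - 1 := by
  simp [oracleWeights, onesMatrix, mul_comm]

lemma integral_noise (hT : ∀ i j, Measurable fun ω => T ω i j)
    (h01 : ∀ ω i j, T ω i j = 0 ∨ T ω i j = 1)
    (hp : ∀ i j, μ.real {ω | T ω i j = 1} = p i j) {i : Fin n₁} {j : Fin n₂} (h0 : 0 < p i j) :
    ∫ ω, ((p i j)⁻¹ * T ω i j - 1) ∂μ = 0 := by
  rw [integral_comp_bernoulli (hT i j) (fun ω => h01 ω i j) (hp i j)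
    (fun y => (p i j)⁻¹ * y - 1)]
  field_simp
  ring

lemma integral_noise_sq (hT : ∀ i j, Measurable fun ω => T ω i j)
    (h01 : ∀ ω i j, T ω i j = 0 ∨ T ω i j = 1)
    (hp : ∀ i j, μ.real {ω | T ω i j = 1} = p i j) {i : Fin n₁} {j : Fin n₂} (h0 : 0 < p i j) :
    ∫ ω, ((p i j)⁻¹ * T ω i j - 1) ^ 2 ∂μ = (p i j)⁻¹ - 1 := by
  rw [integral_comp_bernoulli (hT i j) (fun ω => h01 ω i j) (hp i j)
    (fun y => ((p i j)⁻¹ * y - 1) ^ 2)]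
  field_simp
  ring

lemma measureReal_bilinear_ge_le (hT : ∀ i j, Measurable fun ω => T ω i j)
    (h01 : ∀ ω i j, T ω i j = 0 ∨ T ω i j = 1)
    (hind : iIndepFun (fun (e : Fin n₁ × Fin n₂) (ω : Ω) => T ω e.1 e.2) μ)
    (hp : ∀ i j, μ.real {ω | T ω i j = 1} = p i j) (hpL : 0 < pL) (hpp : ∀ i j, pL ≤ p i j)
    {y : EuclideanSpace ℝ (Fin n₁)} {x : EuclideanSpace ℝ (Fin n₂)} (hy : ‖y‖ ≤ 2)
    (hx : ‖x‖ ≤ 2) :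
    μ.real {ω | 8 * √((n₁ : ℝ) + n₂) / pL ≤ inner ℝ y
      (Matrix.toEuclideanLin (T ω ⊙ oracleWeights p - onesMatrix n₁ n₂) x)} ≤
      Real.exp (-(8 * ((n₁ : ℝ) + n₂))) := by
  have hp0 : ∀ i j, 0 < p i j := fun i j => hpL.trans_le (hpp i j)
  set N : ℝ := (n₁ : ℝ) + n₂
  have hN : 0 ≤ N := by positivity
  set Z : Fin n₁ × Fin n₂ → Ω → ℝ := fun e ω =>
    (y e.1 * x e.2) * ((p e.1 e.2)⁻¹ * T ω e.1 e.2 - 1) with hZ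
  have hZind : iIndepFun Z μ :=
    hind.comp (fun e z => (y e.1 * x e.2) * ((p e.1 e.2)⁻¹ * z - 1)) fun e => by fun_prop
  have hsum : ∀ ω, inner ℝ y
      (Matrix.toEuclideanLin (T ω ⊙ oracleWeights p - onesMatrix n₁ n₂) x) = ∑ e, Z e ω :=
    fun ω => by
      rw [inner_toEuclideanLin, Fintype.sum_prod_type]
      simp only [oracle_noise_apply, hZ, mul_comm]
  have hsg : ∀ e ∈ Finset.univ, HasSubgaussianMGF (Z e)
      (NNReal.mk ((y e.1 * x e.2) ^ 2) (sq_nonneg _) *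
        ((‖((p e.1 e.2)⁻¹ - 1) - (-1)‖₊ / 2) ^ 2)) μ :=
    fun e _ => by
      refine HasSubgaussianMGF.const_mul (hasSubgaussianMGF_of_mem_Icc_of_integral_eq_zero
        (((hT e.1 e.2).const_mul _).sub_const 1).aemeasurable
        (Filter.Eventually.of_forall fun ω => ?_) (integral_noise hT h01 hp (hp0 _ _))) _
      have := inv_pos.2 (hp0 e.1 e.2)
      rcases h01 ω e.1 e.2 with h | h <;> simp [h, this.le]
  have hS := HasSubgaussianMGF.sum_of_iIndepFun hZind hsg
  set c : NNReal := ∑ e : Fin n₁ × Fin n₂,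
    (NNReal.mk ((y e.1 * x e.2) ^ 2) (sq_nonneg _) *
      ((‖((p e.1 e.2)⁻¹ - 1) - (-1)‖₊ / 2) ^ 2)) with hc
  -- Entry `e` ranges over an interval of length `1/p`, so Hoeffding's parameter is `(1/(2p))²`; the
  -- weights `(y i * x j)²` sum to at most `16`.
  have hc4 : (c : ℝ) ≤ 4 / pL ^ 2 := by
    have h1 : (c : ℝ) = ∑ e : Fin n₁ × Fin n₂, (y e.1 * x e.2) ^ 2 * ((p e.1 e.2)⁻¹ / 2) ^ 2 := by
      rw [hc, NNReal.coe_sum]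
      refine Finset.sum_congr rfl fun e _ => ?_
      rw [NNReal.coe_mul, NNReal.coe_mk, NNReal.coe_pow, NNReal.coe_div, coe_nnnorm,
        sub_neg_eq_add, sub_add_cancel, Real.norm_of_nonneg (inv_nonneg.2 (hp0 _ _).le)]
      rfl
    have h2 : ∑ e : Fin n₁ × Fin n₂, (y e.1 * x e.2) ^ 2 = ‖y‖ ^ 2 * ‖x‖ ^ 2 := by
      rw [EuclideanSpace.real_norm_sq_eq, EuclideanSpace.real_norm_sq_eq, Finset.sum_mul_sum,
        Fintype.sum_prod_type]
      simp only [mul_pow]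
    rw [h1]
    calc _ ≤ ∑ e : Fin n₁ × Fin n₂, (y e.1 * x e.2) ^ 2 * (pL⁻¹ / 2) ^ 2 := by
          refine Finset.sum_le_sum fun e _ => ?_
          have := inv_anti₀ hpL (hpp e.1 e.2)
          have := inv_pos.2 (hp0 e.1 e.2)
          gcongr
      _ = ‖y‖ ^ 2 * ‖x‖ ^ 2 * (pL⁻¹ / 2) ^ 2 := by rw [← Finset.sum_mul, h2]
      _ ≤ 2 ^ 2 * 2 ^ 2 * (pL⁻¹ / 2) ^ 2 := by gcongr
      _ = 4 / pL ^ 2 := by field_simp; norm_num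
  simp only [hsum]
  -- With variance proxy `4/pL²` this minimizes the Chernoff exponent, whose value is then `-16N +
  -- 8N`.
  set t := 2 * √N * pL with ht
  have ht0 : 0 ≤ t := by positivity
  refine (measure_ge_le_exp_mul_mgf _ ht0 (hS.integrable_exp_mul t)).trans ?_
  refine (mul_le_mul_of_nonneg_left (hS.mgf_le t) (Real.exp_nonneg _)).trans ?_
  rw [← Real.exp_add]
  refine Real.exp_le_exp.2 ?_
  have h3 : c * t ^ 2 / 2 ≤ 8 * N := by
    calc c * t ^ 2 / 2 ≤ 4 / pL ^ 2 * t ^ 2 / 2 := by gcongr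
      _ = 8 * √N ^ 2 := by rw [ht]; field_simp; ring
      _ = 8 * N := by rw [Real.sq_sqrt hN]
  have h4 : -t * (8 * √N / pL) = -(16 * N) := by
    have : -t * (8 * √N / pL) = -(16 * √N ^ 2) := by rw [ht]; field_simp; ring
    rw [this, Real.sq_sqrt hN]
  linarith

lemma measureReal_spectralNorm_gt_le (hn₁ : 1 ≤ n₁) (hT : ∀ i j, Measurable fun ω => T ω i j)
    (h01 : ∀ ω i j, T ω i j = 0 ∨ T ω i j = 1)
    (hind : iIndepFun (fun (e : Fin n₁ × Fin n₂) (ω : Ω) => T ω e.1 e.2) μ)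
    (hp : ∀ i j, μ.real {ω | T ω i j = 1} = p i j) (hpL : 0 < pL) (hpp : ∀ i j, pL ≤ p i j) :
    μ.real {ω | 8 * √((n₁ : ℝ) + n₂) / pL <
      spectralNorm (T ω ⊙ oracleWeights p - onesMatrix n₁ n₂)} ≤ 1 / ((n₁ : ℝ) + n₂) := by
  obtain ⟨s₁, hc₁, hb₁, hs₁⟩ := exists_finset_net (EuclideanSpace ℝ (Fin n₁))
  obtain ⟨s₂, hc₂, hb₂, hs₂⟩ := exists_finset_net (EuclideanSpace ℝ (Fin n₂))
  rw [finrank_euclideanSpace_fin] at hc₁ hc₂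
  set N : ℝ := (n₁ : ℝ) + n₂ with hN
  have hN1 : 1 ≤ N := by
    have : (1 : ℝ) ≤ n₁ := by exact_mod_cast hn₁
    have : (0 : ℝ) ≤ n₂ := Nat.cast_nonneg _
    linarith
  have hsub : {ω | 8 * √N / pL < spectralNorm (T ω ⊙ oracleWeights p - onesMatrix n₁ n₂)} ⊆
      ⋃ q ∈ s₁ ×ˢ s₂, {ω | 8 * √N / pL ≤ inner ℝ q.1
        (Matrix.toEuclideanLin (T ω ⊙ oracleWeights p - onesMatrix n₁ n₂) q.2)} := by
    intro ω hω
    by_contra hcon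
    simp only [Set.mem_iUnion, Set.mem_ofPred_eq, not_exists, not_le] at hcon
    exact absurd (spectralNorm_le_of_net (by positivity) hs₁ hs₂ fun c hc d hd =>
      (hcon (c, d) (Finset.mem_product.2 ⟨hc, hd⟩)).le) (not_le.2 hω)
  refine (measureReal_mono hsub (measure_ne_top _ _)).trans
    ((measureReal_biUnion_finset_le _ _).trans ?_)
  have h1 : ∀ q ∈ s₁ ×ˢ s₂, μ.real {ω | 8 * √N / pL ≤ inner ℝ q.1
        (Matrix.toEuclideanLin (T ω ⊙ oracleWeights p - onesMatrix n₁ n₂) q.2)} ≤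
        Real.exp (-(8 * N)) := fun q hq =>
    measureReal_bilinear_ge_le hT h01 hind hp hpL hpp (hb₁ _ (Finset.mem_product.1 hq).1)
      (hb₂ _ (Finset.mem_product.1 hq).2)
  refine (Finset.sum_le_sum h1).trans ?_
  rw [Finset.sum_const, nsmul_eq_mul, Finset.card_product]
  -- The net pairs number at most `5 ^ N ≤ e^(5N)`, against a probability `e^(-8N)` for each.
  have h5 : ((s₁.card * s₂.card : ℕ) : ℝ) ≤ Real.exp (5 * N) := by
    have h6 : s₁.card * s₂.card ≤ 5 ^ (n₁ + n₂) := by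
      rw [pow_add]; exact Nat.mul_le_mul hc₁ hc₂
    calc ((s₁.card * s₂.card : ℕ) : ℝ) ≤ (5 : ℝ) ^ (n₁ + n₂) := by exact_mod_cast h6
      _ ≤ Real.exp 5 ^ (n₁ + n₂) := by
          gcongr
          linarith [Real.add_one_le_exp (5 : ℝ)]
      _ = Real.exp (5 * N) := by
          rw [← Real.exp_nat_mul, hN]; congr 1; push_cast; ring
  calc _ ≤ Real.exp (5 * N) * Real.exp (-(8 * N)) := by gcongr
    _ = Real.exp (-(3 * N)) := by rw [← Real.exp_add]; congr 1; ring
    _ ≤ Real.exp (-N) := Real.exp_le_exp.2 (by linarith)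
    _ ≤ 1 / N := by
        rw [Real.exp_neg, ← one_div]
        exact one_div_le_one_div_of_le (by linarith) (by linarith [Real.add_one_le_exp N])

end RandomMask

/-! ### Hermitian dilation -/

section Dilation

variable {n₁ n₂ : ℕ}

/-- The Hermitian dilation of the matrix unit at position `e`. -/
def dilationUnit (e : Fin n₁ × Fin n₂) : Matrix (Fin n₁ ⊕ Fin n₂) (Fin n₁ ⊕ Fin n₂) ℝ :=
  Matrix.fromBlocks 0 (Matrix.single e.1 e.2 1) (Matrix.single e.2 e.1 1) 0

lemma isSymm_dilationUnit (e : Fin n₁ × Fin n₂) : (dilationUnit e).IsSymm := by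
  simp [dilationUnit, Matrix.IsSymm, Matrix.fromBlocks_transpose]

lemma dilationUnit_mul_self (e : Fin n₁ × Fin n₂) : dilationUnit e * dilationUnit e =
    Matrix.diagonal (Sum.elim (Pi.single e.1 1) (Pi.single e.2 1)) := by
  rw [dilationUnit, Matrix.fromBlocks_multiply, ← Matrix.fromBlocks_diagonal]
  simp [Matrix.diagonal_single]

lemma dilationUnit_mul_of_ne {e e' : Fin n₁ × Fin n₂} (h₁ : e.1 ≠ e'.1) (h₂ : e.2 ≠ e'.2) :
    dilationUnit e * dilationUnit e' = 0 := by
  rw [dilationUnit, dilationUnit, Matrix.fromBlocks_multiply,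
    Matrix.single_mul_single_of_ne _ _ _ _ h₁, Matrix.single_mul_single_of_ne _ _ _ _ h₂]
  simp

lemma sum_smul_dilationUnit (X : Matrix (Fin n₁) (Fin n₂) ℝ) :
    ∑ e : Fin n₁ × Fin n₂, X e.1 e.2 • dilationUnit e = Matrix.fromBlocks 0 X Xᵀ 0 := by
  ext a b
  rw [Matrix.sum_apply]
  rcases a with a | a <;> rcases b with b | b
  · simp [dilationUnit]
  · simp only [dilationUnit, Matrix.smul_apply, Matrix.fromBlocks_apply₁₂, smul_eq_mul]
    rw [Finset.sum_eq_single (a, b)]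
    · simp
    · rintro ⟨i, j⟩ - hne
      rw [Matrix.single_apply, if_neg, mul_zero]
      rintro ⟨rfl, rfl⟩
      exact hne rfl
    · simp
  · simp only [dilationUnit, Matrix.smul_apply, Matrix.fromBlocks_apply₂₁, smul_eq_mul]
    rw [Finset.sum_eq_single (b, a)]
    · simp
    · rintro ⟨i, j⟩ - hne
      rw [Matrix.single_apply, if_neg, mul_zero]
      rintro ⟨rfl, rfl⟩
      exact hne rfl
    · simp
  · simp [dilationUnit]

lemma exp_inner_le_trace_exp (X : Matrix (Fin n₁) (Fin n₂) ℝ) {y : EuclideanSpace ℝ (Fin n₁)}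
    {x : EuclideanSpace ℝ (Fin n₂)} (hy : ‖y‖ = 1) (hx : ‖x‖ = 1) :
    Real.exp (inner ℝ y (Matrix.toEuclideanLin X x)) ≤
      (NormedSpace.exp (∑ e : Fin n₁ × Fin n₂, X e.1 e.2 • dilationUnit e)).trace := by
  -- The test vector `(y, x)/√2` is a unit vector on which the dilation of `X` has quadratic form
  -- exactly `⟨y, X x⟩`.
  set c : ℝ := √(1 / 2) with hc
  have hcc : c * c = 1 / 2 := Real.mul_self_sqrt (by norm_num)
  have hyy : y.ofLp ⬝ᵥ y.ofLp = 1 := by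
    rw [← one_pow 2, ← hy, EuclideanSpace.real_norm_sq_eq]
    simp [dotProduct, pow_two]
  have hxx : x.ofLp ⬝ᵥ x.ofLp = 1 := by
    rw [← one_pow 2, ← hx, EuclideanSpace.real_norm_sq_eq]
    simp [dotProduct, pow_two]
  have hw : Sum.elim (c • y.ofLp) (c • x.ofLp) ⬝ᵥ Sum.elim (c • y.ofLp) (c • x.ofLp) = 1 := by
    rw [sumElim_dotProduct_sumElim]
    simp only [smul_dotProduct, dotProduct_smul, hyy, hxx, smul_eq_mul]
    linarith
  have hs : (∑ e : Fin n₁ × Fin n₂, X e.1 e.2 • dilationUnit e).IsSymm := by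
    rw [Matrix.IsSymm, Matrix.transpose_sum]
    exact Finset.sum_congr rfl fun e _ => (isSymm_dilationUnit e).smul _
  refine le_trans (le_of_eq ?_) (exp_dotProduct_mulVec_le_trace_exp hs hw)
  congr 1
  have hin : inner ℝ y (Matrix.toEuclideanLin X x) = y.ofLp ⬝ᵥ X *ᵥ x.ofLp := by
    rw [inner_toEuclideanLin]
    simp only [dotProduct, Matrix.mulVec, Finset.mul_sum]
    exact Finset.sum_congr rfl fun i _ => Finset.sum_congr rfl fun j _ => by ring
  have hcomm : x.ofLp ⬝ᵥ Xᵀ *ᵥ y.ofLp = y.ofLp ⬝ᵥ X *ᵥ x.ofLp := by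
    rw [Matrix.mulVec_transpose, dotProduct_comm, Matrix.dotProduct_mulVec]
  rw [hin, sum_smul_dilationUnit, Matrix.fromBlocks_mulVec]
  simp only [Sum.elim_comp_inl, Sum.elim_comp_inr, Matrix.zero_mulVec, zero_add, add_zero]
  rw [sumElim_dotProduct_sumElim]
  simp only [Matrix.mulVec_smul, smul_dotProduct, dotProduct_smul, hcomm, smul_eq_mul]
  linear_combination (-2 * (y.ofLp ⬝ᵥ X *ᵥ x.ofLp)) * hcc

end Dilation

/-! ### The logarithmic tail bound for the noise -/

section MatrixChernoff

variable {n₁ n₂ : ℕ} {Ω : Type*} [MeasurableSpace Ω] {μ : Measure Ω} [IsProbabilityMeasure μ]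
  {T : Ω → Matrix (Fin n₁) (Fin n₂) ℝ} {p : Matrix (Fin n₁) (Fin n₂) ℝ} {pL : ℝ}

lemma integral_trace_exp_noise_le (hn₁ : 1 ≤ n₁) (hT : ∀ i j, Measurable fun ω => T ω i j)
    (h01 : ∀ ω i j, T ω i j = 0 ∨ T ω i j = 1)
    (hind : iIndepFun (fun (e : Fin n₁ × Fin n₂) (ω : Ω) => T ω e.1 e.2) μ)
    (hp : ∀ i j, μ.real {ω | T ω i j = 1} = p i j) (hpL : 0 < pL) (hpp : ∀ i j, pL ≤ p i j)
    {l : ℝ} (hl0 : 0 ≤ l) (hl : l ≤ pL) :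
    ∫ ω, (NormedSpace.exp (∑ e : Fin n₁ × Fin n₂,
      (l * ((p e.1 e.2)⁻¹ * T ω e.1 e.2 - 1)) • dilationUnit e)).trace ∂μ ≤
      (1 + l ^ 2 / pL) ^ max n₁ n₂ * ((n₁ : ℝ) + n₂) := by
  have hp0 : ∀ i j, 0 < p i j := fun i j => hpL.trans_le (hpp i j)
  have hp1 : ∀ i j, p i j ≤ 1 := fun i j => hp i j ▸ measureReal_le_one
  have hinv : ∀ i j, (p i j)⁻¹ ≤ pL⁻¹ := fun i j => inv_anti₀ hpL (hpp i j)
  have hinv1 : ∀ i j, 1 ≤ (p i j)⁻¹ := fun i j => (one_le_inv₀ (hp0 i j)).2 (hp1 i j)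
  set K := max n₁ n₂ with hK
  have hK0 : 0 < K := lt_of_lt_of_le hn₁ (le_max_left _ _)
  -- Cyclic diagonals. As `K` is at least both dimensions, a residue of `i + j` together with one
  -- coordinate determines the other, so a colour meets each row and column at most once.
  let col : Fin n₁ × Fin n₂ → Fin K := fun e => ⟨(e.1 + e.2) % K, Nat.mod_lt _ hK0⟩
  have hcol1 : ∀ e e' : Fin n₁ × Fin n₂, col e = col e' → e.1 = e'.1 → e = e' := by
    rintro ⟨i, j⟩ ⟨i', j'⟩ h (rfl : i = i')
    have h1 : (i + j : ℕ) ≡ i + j' [MOD K] := congrArg Fin.val h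
    have h2 : (j : ℕ) ≡ j' [MOD K] := Nat.ModEq.add_left_cancel' _ h1
    have h3 := Nat.ModEq.eq_of_lt_of_lt h2 (j.2.trans_le (le_max_right _ _))
      (j'.2.trans_le (le_max_right _ _))
    rw [Fin.ext h3]
  have hcol2 : ∀ e e' : Fin n₁ × Fin n₂, col e = col e' → e.2 = e'.2 → e = e' := by
    rintro ⟨i, j⟩ ⟨i', j'⟩ h (rfl : j = j')
    have h1 : (i + j : ℕ) ≡ i' + j [MOD K] := congrArg Fin.val h
    have h2 : (i : ℕ) ≡ i' [MOD K] := Nat.ModEq.add_right_cancel' _ h1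
    have h3 := Nat.ModEq.eq_of_lt_of_lt h2 (i.2.trans_le (le_max_left _ _))
      (i'.2.trans_le (le_max_left _ _))
    rw [Fin.ext h3]
  have := integral_trace_exp_le (μ := μ)
    (x := fun e ω => l * ((p e.1 e.2)⁻¹ * T ω e.1 e.2 - 1)) (B := dilationUnit)
    (D := fun e => Sum.elim (Pi.single e.1 1) (Pi.single e.2 1)) (v := l ^ 2 / pL) col
    (fun e => (((hT e.1 e.2).const_mul _).sub_const 1).const_mul l)
    (hind.comp (fun e y => l * ((p e.1 e.2)⁻¹ * y - 1)) fun e => by fun_prop)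
    ?_ ?_ ?_ (by positivity) isSymm_dilationUnit dilationUnit_mul_self ?_ ?_ ?_
  · simpa using this
  · intro e ω
    have h1 : |(p e.1 e.2)⁻¹ * T ω e.1 e.2 - 1| ≤ pL⁻¹ := by
      have := hinv e.1 e.2
      have := hinv1 e.1 e.2
      rcases h01 ω e.1 e.2 with h | h <;> rw [h, abs_le] <;> constructor <;> linarith
    rw [abs_mul, abs_of_nonneg hl0]
    calc _ ≤ pL * pL⁻¹ := mul_le_mul hl h1 (abs_nonneg _) hpL.le
      _ = 1 := mul_inv_cancel₀ hpL.ne'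
  · intro e
    rw [integral_const_mul, integral_noise hT h01 hp (hp0 _ _), mul_zero]
  · intro e
    simp only [mul_pow]
    rw [integral_const_mul, integral_noise_sq hT h01 hp (hp0 _ _), div_eq_mul_inv]
    gcongr
    linarith [hinv e.1 e.2]
  · rintro e (a | a)
    · exact (Pi.single_nonneg.2 zero_le_one : (0 : Fin n₁ → ℝ) ≤ Pi.single e.1 1) a
    · exact (Pi.single_nonneg.2 zero_le_one : (0 : Fin n₂ → ℝ) ≤ Pi.single e.2 1) a
  · exact fun e e' h hne => dilationUnit_mul_of_ne (fun h1 => hne (hcol1 e e' h h1))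
      fun h2 => hne (hcol2 e e' h h2)
  · rintro c (a | a)
    · simp only [Sum.elim_inl, Pi.single_apply]
      rw [Finset.sum_boole]
      norm_cast
      refine Finset.card_le_one.2 fun e he e' he' => ?_
      simp only [Finset.mem_filter, Finset.mem_univ, true_and] at he he'
      exact hcol1 e e' (he.1.trans he'.1.symm) (he.2.symm.trans he'.2)
    · simp only [Sum.elim_inr, Pi.single_apply]
      rw [Finset.sum_boole]
      norm_cast
      refine Finset.card_le_one.2 fun e he e' he' => ?_
      simp only [Finset.mem_filter, Finset.mem_univ, true_and] at he he'
      exact hcol2 e e' (he.1.trans he'.1.symm) (he.2.symm.trans he'.2)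

lemma measureReal_spectralNorm_gt_le_of_log_le (hn₁ : 1 ≤ n₁) (hn₂ : 1 ≤ n₂)
    (hT : ∀ i j, Measurable fun ω => T ω i j)
    (h01 : ∀ ω i j, T ω i j = 0 ∨ T ω i j = 1)
    (hind : iIndepFun (fun (e : Fin n₁ × Fin n₂) (ω : Ω) => T ω e.1 e.2) μ)
    (hp : ∀ i j, μ.real {ω | T ω i j = 1} = p i j) (hpL : 0 < pL) (hpp : ∀ i j, pL ≤ p i j)
    (hlog : Real.log ((n₁ : ℝ) + n₂) ≤ pL * max (n₁ : ℝ) n₂) :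
    μ.real {ω | 3 * √(max (n₁ : ℝ) n₂ * Real.log ((n₁ : ℝ) + n₂) / pL) <
      spectralNorm (T ω ⊙ oracleWeights p - onesMatrix n₁ n₂)} ≤ 1 / ((n₁ : ℝ) + n₂) := by
  have h1 : (1 : ℝ) ≤ n₁ := by exact_mod_cast hn₁
  have h2 : (1 : ℝ) ≤ n₂ := by exact_mod_cast hn₂
  set N : ℝ := (n₁ : ℝ) + n₂ with hN
  set K : ℝ := max (n₁ : ℝ) n₂ with hK
  set L := Real.log N with hL
  have hN0 : 0 < N := by positivity
  have hK0 : 0 < K := lt_of_lt_of_le (by linarith) (le_max_left (n₁ : ℝ) n₂)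
  have hL0 : 0 < L := Real.log_pos (by linarith)
  have hexpL : Real.exp L = N := Real.exp_log hN0
  -- This choice gives `(1 + l²/pL)^K ≤ e^L = N` and turns the threshold into `3L`. Markov's
  -- inequality then compares a mean of at most `N²` with the level `N³`. The hypothesis `hlog` is
  -- what makes `l ≤ pL`.
  set l := √(pL * L / K) with hl
  have hl2 : l ^ 2 = pL * L / K := Real.sq_sqrt (by positivity)
  have hl0 : 0 < l := Real.sqrt_pos.2 (by positivity)
  have hlp : l ≤ pL := by
    refine Real.sqrt_le_iff.2 ⟨hpL.le, ?_⟩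
    rw [div_le_iff₀ hK0]
    nlinarith
  have hlt : l * (3 * √(K * L / pL)) = 3 * L := by
    have : √(pL * L / K) * √(K * L / pL) = L := by
      rw [← Real.sqrt_mul (by positivity)]
      have : pL * L / K * (K * L / pL) = L ^ 2 := by field_simp
      rw [this, Real.sqrt_sq hL0.le]
    linear_combination 3 * this
  set F : Ω → ℝ := fun ω => (NormedSpace.exp (∑ e : Fin n₁ × Fin n₂,
      (l * ((p e.1 e.2)⁻¹ * T ω e.1 e.2 - 1)) • dilationUnit e)).trace with hF
  have hsub : {ω | 3 * √(K * L / pL) <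
      spectralNorm (T ω ⊙ oracleWeights p - onesMatrix n₁ n₂)} ⊆
      {ω | Real.exp (3 * L) ≤ F ω} := by
    intro ω hω
    by_contra hcon
    simp only [Set.mem_ofPred_eq, not_le] at hcon
    refine absurd (spectralNorm_le_of_inner_le (by positivity) fun y x hy hx => ?_) (not_le.2 hω)
    set X := T ω ⊙ oracleWeights p - onesMatrix n₁ n₂ with hX
    have h3 := exp_inner_le_trace_exp (l • X) hy hx
    have h4 : (∑ e : Fin n₁ × Fin n₂, (l • X) e.1 e.2 • dilationUnit e) = ∑ e : Fin n₁ × Fin n₂,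
        (l * ((p e.1 e.2)⁻¹ * T ω e.1 e.2 - 1)) • dilationUnit e :=
      Finset.sum_congr rfl fun e _ => by
        rw [Matrix.smul_apply, hX, oracle_noise_apply, smul_eq_mul]
    rw [h4] at h3
    have h5 := Real.exp_lt_exp.1 (h3.trans_lt hcon)
    rw [map_smul, LinearMap.smul_apply, real_inner_smul_right, ← hlt] at h5
    exact (lt_of_mul_lt_mul_left h5 hl0.le).le
  have hFint : Integrable F μ := by
    have hb : ∀ (e : Fin n₁ × Fin n₂) ω, |T ω e.1 e.2| ≤ 1 := fun e ω => by
      rcases h01 ω e.1 e.2 with h | h <;> simp [h]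
    have := integrable_continuous_comp_of_bounded (μ := μ) (x := fun e ω => T ω e.1 e.2)
      (fun e => hT e.1 e.2) hb (continuous_trace_exp_mul
        (f := fun z : Fin n₁ × Fin n₂ → ℝ => ∑ e : Fin n₁ × Fin n₂,
          (l * ((p e.1 e.2)⁻¹ * z e - 1)) • dilationUnit e) (by fun_prop) 1)
    simpa only [mul_one] using this
  have hF0 : ∀ ω, 0 ≤ F ω := fun ω => by
    refine (posSemidef_exp ?_).trace_nonneg
    rw [Matrix.IsSymm, Matrix.transpose_sum]
    exact Finset.sum_congr rfl fun e _ => (isSymm_dilationUnit e).smul _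
  have hmarkov := mul_meas_ge_le_integral_of_nonneg (Filter.Eventually.of_forall hF0) hFint
    (Real.exp (3 * L))
  have hmean := integral_trace_exp_noise_le hn₁ hT h01 hind hp hpL hpp hl0.le hlp
  have hpow : (1 + l ^ 2 / pL) ^ max n₁ n₂ ≤ N := by
    have h6 : l ^ 2 / pL = L / K := by rw [hl2]; field_simp
    have h7 : 1 + L / K ≤ Real.exp (L / K) := by linarith [Real.add_one_le_exp (L / K)]
    rw [h6]
    refine (pow_le_pow_left₀ (by positivity) h7 _).trans (le_of_eq ?_)
    rw [← Real.exp_nat_mul, Nat.cast_max, ← hK, mul_div_cancel₀ _ hK0.ne', hexpL]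
  have h8 : Real.exp (3 * L) = N * N * N := by
    rw [← hexpL, ← Real.exp_add, ← Real.exp_add]; congr 1; ring
  have h9 : N * N * N * μ.real {ω | Real.exp (3 * L) ≤ F ω} ≤ N * N := by
    rw [← h8]
    exact hmarkov.trans (hmean.trans (by gcongr))
  refine (measureReal_mono hsub).trans ?_
  rw [le_div_iff₀ hN0]
  have h10 : N * N * (μ.real {ω | Real.exp (3 * L) ≤ F ω} * N) ≤ N * N * 1 := by linarith
  exact le_of_mul_le_mul_left h10 (by positivity)

end MatrixChernoff

/-! ### Existence of solutions and the trivial bound -/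

section Optimization

variable {n₁ n₂ : ℕ} {t p : Matrix (Fin n₁) (Fin n₂) ℝ} {κ : ℝ}

/-- Entries of `W` where `t` vanishes are unbounded above but affect neither the constraint nor the
objective. Resetting them to `1` brings every feasible `W` into the compact set `Q` without changing
its value. -/
lemma exists_isBalancingWeights (h01 : ∀ i j, t i j = 0 ∨ t i j = 1)
    (hne : (feasibleWeights t κ).Nonempty) : ∃ W, IsBalancingWeights t κ W := by
  let Q : Set (Matrix (Fin n₁) (Fin n₂) ℝ) :=
    {W | frobNorm (t ⊙ W) ≤ κ ∧ ∀ i j, 1 ≤ W i j ∧ W i j ≤ max 1 κ}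
  let red : Matrix (Fin n₁) (Fin n₂) ℝ → Matrix (Fin n₁) (Fin n₂) ℝ :=
    fun W => Matrix.of fun i j => if t i j = 0 then 1 else W i j
  have hred : ∀ W, t ⊙ red W = t ⊙ W := fun W => by
    ext i j
    by_cases h : t i j = 0 <;> simp [red, h]
  have hredQ : ∀ W ∈ feasibleWeights t κ, red W ∈ Q := by
    rintro W ⟨h1, h2⟩
    refine ⟨by rwa [hred], fun i j => ?_⟩
    rcases h01 i j with h | h
    · simp [red, h]
    · have h3 : W i j ≤ κ := by
        refine le_trans (Real.le_sqrt_of_sq_le ?_) h1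
        have h4 : W i j ^ 2 = (t ⊙ W) i j ^ 2 := by simp [h]
        rw [h4]
        exact (Finset.single_le_sum (f := fun j => (t ⊙ W) i j ^ 2) (fun _ _ => sq_nonneg _)
          (Finset.mem_univ j)).trans
          (Finset.single_le_sum (f := fun i => ∑ j, (t ⊙ W) i j ^ 2)
            (fun _ _ => Finset.sum_nonneg fun _ _ => sq_nonneg _) (Finset.mem_univ i))
      simp [red, h, h2 i j, h3]
  have hcont : Continuous fun W : Matrix (Fin n₁) (Fin n₂) ℝ =>
      spectralNorm (t ⊙ W - onesMatrix n₁ n₂) := by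
    have h1 : Continuous fun A : Matrix (Fin n₁) (Fin n₂) ℝ =>
        LinearMap.toContinuousLinearMap (Matrix.toEuclideanLin A) :=
      (LinearMap.toContinuousLinearMap.toLinearMap ∘ₗ
        (Matrix.toEuclideanLin (𝕜 := ℝ) (m := Fin n₁)
          (n := Fin n₂)).toLinearMap).continuous_of_finiteDimensional
    have h2 : Continuous fun W : Matrix (Fin n₁) (Fin n₂) ℝ => t ⊙ W - onesMatrix n₁ n₂ := by
      refine Continuous.sub (continuous_matrix fun i j => ?_) continuous_const
      simp only [Matrix.hadamard_apply]
      exact continuous_const.mul (continuous_id.matrix_elem i j)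
    exact (h1.comp h2).norm
  have hQ : IsCompact Q := by
    have hbox : IsCompact (Set.univ.pi fun _ : Fin n₁ => Set.univ.pi fun _ : Fin n₂ =>
        Set.Icc (1 : ℝ) (max 1 κ)) :=
      isCompact_univ_pi fun _ => isCompact_univ_pi fun _ => isCompact_Icc
    have hclosed : IsClosed {W : Matrix (Fin n₁) (Fin n₂) ℝ | frobNorm (t ⊙ W) ≤ κ} := by
      refine isClosed_le ?_ continuous_const
      unfold frobNorm
      simp only [Matrix.hadamard_apply]
      refine Real.continuous_sqrt.comp (continuous_finsetSum _ fun i _ =>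
        continuous_finsetSum _ fun j _ => ?_)
      exact (continuous_const.mul (continuous_id.matrix_elem i j)).pow 2
    have hQeq : Q = (Set.univ.pi fun _ : Fin n₁ => Set.univ.pi fun _ : Fin n₂ =>
        Set.Icc (1 : ℝ) (max 1 κ)) ∩ {W : Matrix (Fin n₁) (Fin n₂) ℝ | frobNorm (t ⊙ W) ≤ κ} := by
      ext W
      constructor
      · exact fun h => ⟨fun i _ j _ => h.2 i j, h.1⟩
      · exact fun h => ⟨h.2, fun i j => h.1 i trivial j trivial⟩
    rw [hQeq]
    exact hbox.inter_right hclosed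
  obtain ⟨W₀, hW₀⟩ := hne
  obtain ⟨W, hW, hmin⟩ := hQ.exists_isMinOn ⟨_, hredQ W₀ hW₀⟩ hcont.continuousOn
  refine ⟨W, ⟨hW.1, fun i j => (hW.2 i j).1⟩, fun W' hW' => ?_⟩
  have := hmin (hredQ W' hW')
  simpa only [Set.mem_ofPred_eq, hred] using this

lemma onesMatrix_mem_feasibleWeights {W : Matrix (Fin n₁) (Fin n₂) ℝ}
    (hW : W ∈ feasibleWeights t κ) : onesMatrix n₁ n₂ ∈ feasibleWeights t κ := by
  refine ⟨le_trans (Real.sqrt_le_sqrt ?_) hW.1, fun i j => le_rfl⟩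
  refine Finset.sum_le_sum fun i _ => Finset.sum_le_sum fun j _ => ?_
  rw [Matrix.hadamard_apply, Matrix.hadamard_apply, mul_pow, mul_pow]
  have h1 : onesMatrix n₁ n₂ i j ≤ W i j := hW.2 i j
  have h0 : 0 ≤ onesMatrix n₁ n₂ i j := zero_le_one
  gcongr

lemma IsBalancingWeights.spectralNorm_le_sqrt (h01 : ∀ i j, t i j = 0 ∨ t i j = 1)
    {W : Matrix (Fin n₁) (Fin n₂) ℝ} (hW : IsBalancingWeights t κ W) :
    spectralNorm (t ⊙ W - onesMatrix n₁ n₂) ≤ √((n₁ : ℝ) * n₂) := by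
  refine (hW.2 (onesMatrix_mem_feasibleWeights hW.1)).trans
    (spectralNorm_le_of_abs_le_one fun i j => ?_)
  rcases h01 i j with h | h <;> simp [onesMatrix, h]

end Optimization

/-! ### Assembling the two rates -/

section Main

variable {n₁ n₂ : ℕ} {Ω : Type*} [MeasurableSpace Ω] {μ : Measure Ω} [IsProbabilityMeasure μ]
  {T : Ω → Matrix (Fin n₁) (Fin n₂) ℝ} {p : Matrix (Fin n₁) (Fin n₂) ℝ} {pL κ : ℝ}

lemma exists_event_spectralNorm_le (hn₁ : 1 ≤ n₁) (hn₂ : 1 ≤ n₂)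
    (hT : ∀ i j, Measurable fun ω => T ω i j)
    (h01 : ∀ ω i j, T ω i j = 0 ∨ T ω i j = 1)
    (hind : iIndepFun (fun (e : Fin n₁ × Fin n₂) (ω : Ω) => T ω e.1 e.2) μ)
    (hp : ∀ i j, μ.real {ω | T ω i j = 1} = p i j) (hpL : 0 < pL) (hpp : ∀ i j, pL ≤ p i j) :
    ∃ G : Set Ω, μ.real Gᶜ ≤ 1 / ((n₁ : ℝ) + n₂) ∧
      ∀ ω ∈ G, oracleWeights p ∈ feasibleWeights (T ω) κ →
        ∀ W, IsBalancingWeights (T ω) κ W →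
          spectralNorm (T ω ⊙ W - onesMatrix n₁ n₂) ≤
            8 * (√((n₁ : ℝ) * n₂) * balancingRate n₁ n₂ pL) := by
  have h1 : (1 : ℝ) ≤ n₁ := by exact_mod_cast hn₁
  have h2 : (1 : ℝ) ≤ n₂ := by exact_mod_cast hn₂
  have hr : 0 < √((n₁ : ℝ) * n₂) := Real.sqrt_pos.2 (by positivity)
  have hL0 : 0 < Real.log ((n₁ : ℝ) + n₂) := Real.log_pos (by linarith)
  have hm0 : 0 < min (n₁ : ℝ) n₂ := lt_min (by linarith) (by linarith)
  have hK0 : 0 < max (n₁ : ℝ) n₂ := hm0.trans_le min_le_max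
  have hopt : ∀ ω, oracleWeights p ∈ feasibleWeights (T ω) κ →
      ∀ W, IsBalancingWeights (T ω) κ W → spectralNorm (T ω ⊙ W - onesMatrix n₁ n₂) ≤
        spectralNorm (T ω ⊙ oracleWeights p - onesMatrix n₁ n₂) := fun ω hω W hW => hW.2 hω
  -- Only the tail bound for the smaller of the two rates is invoked, so the failure probability
  -- `1/N` is paid once.
  rcases min_choice (√(Real.log ((n₁ : ℝ) + n₂)) / √(pL * min (n₁ : ℝ) n₂))
    (√((n₁ : ℝ) + n₂) / (pL * √((n₁ : ℝ) * n₂))) with h | h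
  · have hrate : √((n₁ : ℝ) * n₂) * balancingRate n₁ n₂ pL =
        √(max (n₁ : ℝ) n₂ * Real.log ((n₁ : ℝ) + n₂) / pL) := by
      rw [balancingRate, h, ← Real.sqrt_div hL0.le, ← Real.sqrt_mul (by positivity)]
      congr 1
      rw [← max_mul_min (n₁ : ℝ) n₂]
      field_simp
    rcases le_or_gt (Real.log ((n₁ : ℝ) + n₂)) (pL * max (n₁ : ℝ) n₂) with hlog | hlog
    · refine ⟨{ω | spectralNorm (T ω ⊙ oracleWeights p - onesMatrix n₁ n₂) ≤
        3 * √(max (n₁ : ℝ) n₂ * Real.log ((n₁ : ℝ) + n₂) / pL)}, ?_, fun ω hω hf W hW => ?_⟩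
      · refine le_trans (measureReal_mono fun ω hω => ?_)
          (measureReal_spectralNorm_gt_le_of_log_le hn₁ hn₂ hT h01 hind hp hpL hpp hlog)
        simpa only [Set.mem_compl_iff, Set.mem_ofPred_eq, not_le] using hω
      · rw [hrate]
        refine (hopt ω hf W hW).trans (le_trans hω ?_)
        gcongr
        norm_num
    -- Here `pL * min ≤ pL * max < log N`, so the rate is at least `1` and the deterministic bound
    -- `√(n₁ n₂)` suffices.
    · refine ⟨Set.univ, by simp; positivity, fun ω _ hf W hW => ?_⟩
      have hle : √((n₁ : ℝ) * n₂) ≤ √((n₁ : ℝ) * n₂) * balancingRate n₁ n₂ pL := by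
        rw [hrate]
        refine Real.sqrt_le_sqrt ?_
        rw [le_div_iff₀ hpL, ← max_mul_min (n₁ : ℝ) n₂, mul_assoc]
        refine mul_le_mul_of_nonneg_left (le_trans ?_ hlog.le) hK0.le
        rw [mul_comm]
        exact mul_le_mul_of_nonneg_left min_le_max hpL.le
      have := hW.spectralNorm_le_sqrt (h01 ω)
      linarith
  · have hrate : √((n₁ : ℝ) * n₂) * balancingRate n₁ n₂ pL = √((n₁ : ℝ) + n₂) / pL := by
      rw [balancingRate, h]
      field_simp
    refine ⟨{ω | spectralNorm (T ω ⊙ oracleWeights p - onesMatrix n₁ n₂) ≤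
      8 * √((n₁ : ℝ) + n₂) / pL}, ?_, fun ω hω hf W hW => ?_⟩
    · refine le_trans (measureReal_mono fun ω hω => ?_)
        (measureReal_spectralNorm_gt_le hn₁ hT h01 hind hp hpL hpp)
      simpa only [Set.mem_compl_iff, Set.mem_ofPred_eq, not_le] using hω
    · rw [hrate, ← mul_div_assoc]
      exact (hopt ω hf W hW).trans hω

/-- Subadditivity suffices, so the events need not be shown measurable. -/
lemma one_sub_measureReal_compl_le (s : Set Ω) : 1 - μ.real sᶜ ≤ μ.real s := by
  have := measureReal_union_le (μ := μ) s sᶜ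
  rw [Set.union_compl_self, probReal_univ] at this
  linarith

end Main

end MatrixBalancing

theorem mainTheorem2 :
    ∃ C : ℝ, 0 < C ∧
      ∀ (n₁ n₂ : ℕ), 1 ≤ n₁ → 1 ≤ n₂ →
      ∀ (Ω : Type*) [MeasurableSpace Ω] (μ : Measure Ω) [IsProbabilityMeasure μ]
        (T : Ω → Matrix (Fin n₁) (Fin n₂) ℝ) (p : Matrix (Fin n₁) (Fin n₂) ℝ) (pL κ β' : ℝ),
      (∀ i j, Measurable fun ω => T ω i j) →
      (∀ ω i j, T ω i j = 0 ∨ T ω i j = 1) →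
      iIndepFun (fun (e : Fin n₁ × Fin n₂) (ω : Ω) => T ω e.1 e.2) μ →
      (∀ i j, μ.real {ω | T ω i j = 1} = p i j) →
      0 < pL →
      (∀ i j, pL ≤ p i j) →
      Real.sqrt (2 * ∑ i, ∑ j, (p i j)⁻¹) ≤ κ →
      0 ≤ β' →
      1 - Real.exp (-(2⁻¹ * Real.log 2 * pL ^ 2 * ∑ i, ∑ j, (p i j)⁻¹)) ≤
          μ.real {ω | MatrixBalancing.oracleWeights p ∈ MatrixBalancing.feasibleWeights (T ω) κ} ∧
      1 - Real.exp (-(2⁻¹ * Real.log 2 * pL ^ 2 * ∑ i, ∑ j, (p i j)⁻¹)) - 1 / ((n₁ : ℝ) + n₂) ≤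
          μ.real {ω |
            MatrixBalancing.oracleWeights p ∈ MatrixBalancing.feasibleWeights (T ω) κ ∧
            (∃ W, MatrixBalancing.IsBalancingWeights (T ω) κ W) ∧
            ∀ W, MatrixBalancing.IsBalancingWeights (T ω) κ W →
              ∀ D, MatrixBalancing.maxNorm D ≤ β' →
                MatrixBalancing.balancingError (T ω) W D ≤
                  C * β' ^ 2 * MatrixBalancing.balancingRate n₁ n₂ pL} := by
  refine ⟨8, by norm_num, ?_⟩
  intro n₁ n₂ hn₁ hn₂ Ω _ μ _ T p pL κ β' hT h01 hind hp hpL hpp hκ hβ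
  set F : Set Ω := {ω | MatrixBalancing.oracleWeights p ∈ MatrixBalancing.feasibleWeights (T ω) κ}
    with hF
  have hbad : μ.real Fᶜ ≤ Real.exp (-(2⁻¹ * Real.log 2 * pL ^ 2 * ∑ i, ∑ j, (p i j)⁻¹)) :=
    MatrixBalancing.measureReal_not_feasible_le hT h01 hind hp hpL hpp hκ
  obtain ⟨G, hG, hGω⟩ := MatrixBalancing.exists_event_spectralNorm_le (κ := κ) hn₁ hn₂ hT h01 hind
    hp hpL hpp
  refine ⟨by linarith [MatrixBalancing.one_sub_measureReal_compl_le (μ := μ) F], ?_⟩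
  have hFG : 1 - Real.exp (-(2⁻¹ * Real.log 2 * pL ^ 2 * ∑ i, ∑ j, (p i j)⁻¹)) -
      1 / ((n₁ : ℝ) + n₂) ≤ μ.real (F ∩ G) := by
    have h1 := MatrixBalancing.one_sub_measureReal_compl_le (μ := μ) (F ∩ G)
    have h2 := measureReal_union_le (μ := μ) Fᶜ Gᶜ
    rw [← Set.compl_inter] at h2
    linarith
  refine hFG.trans (measureReal_mono fun ω hω => ?_)
  refine ⟨hω.1, MatrixBalancing.exists_isBalancingWeights (h01 ω) ⟨_, hω.1⟩, fun W hW D hD => ?_⟩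
  refine (MatrixBalancing.balancingError_le hD).trans ?_
  have hn : (0 : ℝ) < (n₁ : ℝ) * n₂ := by positivity
  have hr := Real.mul_self_sqrt hn.le
  -- One factor `√(n₁ n₂)` comes from the duality and one from the spectral bound; together they
  -- cancel the normalization `(n₁ n₂)⁻¹`.
  calc _ ≤ ((n₁ : ℝ) * n₂)⁻¹ * (8 * (√((n₁ : ℝ) * n₂) *
        MatrixBalancing.balancingRate n₁ n₂ pL) * √((n₁ : ℝ) * n₂) * β' ^ 2) := by
        gcongr
        exact hGω ω hω.2 hω.1 W hW
    _ = ((n₁ : ℝ) * n₂)⁻¹ * (√((n₁ : ℝ) * n₂) * √((n₁ : ℝ) * n₂)) *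
        (8 * β' ^ 2 * MatrixBalancing.balancingRate n₁ n₂ pL) := by ring
    _ = _ := by rw [hr, inv_mul_cancel₀ hn.ne', one_mul]
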